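/- **Theorem 3.2.** Let $(z_k)_{k\in\mathbb N}$ be a non-decreasing deterministic sequence of positive real numbers with $z_k\to\infty$, let $(X_k)_{k\in\mathbb N}$ be independent random variables with values in $\mathbb N_0=\{0,1,2,\dots\}$, and let $$\nu_n=\sum_{k=1}^\infty X_k\,\delta_{z_k/z_n},\qquad n\in\mathbb N,$$ which are point processes on $(0,\infty)$. For $c>0$ let $\eta_c$ be the Poisson process on $(0,\infty)$ with intensity measure $c\,t^{-1}\,dt$. Equip the space of locally finite measures on $(0,\infty)$ with the vague topology (the coarsest topology for which $\mu\mapsto\int f\,d\mu$ is continuous for every non-negative continuous $f$ with compact support in $(0,\infty)$) and its Borel $\sigma$-algebra; vague convergence in distribution of random measures is convergence in distribution as random elements of this space. For every $c>0$, $\nu_n$ converges vaguely in distribution to $\eta_c$ as $n\to\infty$ if and only if for all $0<a<b<\infty$ (i) $\displaystyle\lim_{n\to\infty}\ \prod_{k:\,a z_n<z_k\le b z_n}\mathbb P(X_k=0)=\Big(\frac ab\Big)^{c}$, and (ii) $\displaystyle\liminf_{n\to\infty}\ \sum_{k:\,a z_n<z_k\le b z_n}\frac{\mathbb P(X_k=1)}{\mathbb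 P(X_k=0)}\ \ge\ c\,\log\frac ba .$ (Under (i), all the denominators in (ii) are positive for large $n$.) In particular, $\nu_n$ converges vaguely in distribution to $\eta_c$ for some $c>0$ if and only if there is a $c>0$ such that (i) and (ii) hold for all $0<a<b<\infty$. -/

import Mathlib

open MeasureTheory ProbabilityTheory Filter Topology Set
open scoped ENNReal NNReal CompactlySupported

/-- The space of locally finite measures on `S`, that is, of measures that are finite on compact
sets (equivalently, on relatively compact Borel sets). -/
structure LocFinMeasure (S : Type*) [TopologicalSpace S] [MeasurableSpace S] where
  /-- The underlying measure. -/
  toMeasure : Measure S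
  /-- Finiteness on compact sets. -/
  finite_on_compacts : IsFiniteMeasureOnCompacts toMeasure

namespace LocFinMeasure

/-- The vague topology: the coarsest topology that makes `μ ↦ ∫ f dμ` continuous for every
non-negative continuous function `f` with compact support. (These integrals are finite, so it
does not matter that they are written as elements of `[0, ∞]`.) -/
noncomputable instance {S : Type*} [TopologicalSpace S] [MeasurableSpace S] :
    TopologicalSpace (LocFinMeasure S) :=
  ⨅ f : C_c(S, ℝ≥0), TopologicalSpace.induced
    (fun μ : LocFinMeasure S => ∫⁻ x, (f x : ℝ≥0∞) ∂μ.toMeasure) inferInstance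

/-- The Borel `σ`-algebra of the vague topology. -/
noncomputable instance {S : Type*} [TopologicalSpace S] [MeasurableSpace S] :
    MeasurableSpace (LocFinMeasure S) :=
  borel (LocFinMeasure S)

instance {S : Type*} [TopologicalSpace S] [MeasurableSpace S] : BorelSpace (LocFinMeasure S) :=
  ⟨rfl⟩

end LocFinMeasure

/-- The random measure `η`, defined on the probability space `(Ω, P)`, is a Poisson process on `S`
with intensity measure `μ`: the mass `η A` of a Borel set `A` with `μ A < ∞` has the Poisson
distribution with mean `μ A`, and the masses of pairwise disjoint sets are independent. -/
structure IsPoissonProcess {Ω S : Type*} [MeasurableSpace Ω] [TopologicalSpace S]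
    [MeasurableSpace S] (η : Ω → LocFinMeasure S) (P : Measure Ω) (μ : Measure S) : Prop where
  measurable : Measurable η
  map_eq : ∀ A : Set S, MeasurableSet A → μ A ≠ ∞ →
    P.map (fun ω => (η ω).toMeasure A) =
      (poissonMeasure (μ A).toNNReal).map (fun m : ℕ => (m : ℝ≥0∞))
  indep : ∀ (m : ℕ) (A : Fin m → Set S), (∀ i, MeasurableSet (A i)) → (∀ i, μ (A i) ≠ ∞) →
    Pairwise (fun i j => Disjoint (A i) (A j)) →
    iIndepFun (fun (i : Fin m) (ω : Ω) => (η ω).toMeasure (A i)) P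

/-- The scale-invariant measure `c t⁻¹ dt` on `(0, ∞)`. -/
noncomputable def scaleInvariantIntensity (c : ℝ) : Measure (Ioi (0 : ℝ)) :=
  (Measure.comap Subtype.val (volume : Measure ℝ)).withDensity
    (fun t => ENNReal.ofReal (c * (t : ℝ)⁻¹))

/-- For positive numbers `z k → ∞` the measure `∑ₖ x k • δ_{z k / s}` on `(0, ∞)` is finite on
compact sets. -/
theorem isFiniteMeasureOnCompacts_sum_dirac (z : ℕ → ℝ) (hpos : ∀ k, 0 < z k)
    (htop : Tendsto z atTop atTop) (x : ℕ → ℕ) {s : ℝ} (hs : 0 < s) :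
    IsFiniteMeasureOnCompacts (Measure.sum fun k => (x k : ℝ≥0∞) •
      Measure.dirac (⟨z k / s, div_pos (hpos k) hs⟩ : Ioi (0 : ℝ))) := by
  refine ⟨fun K hK => ?_⟩
  obtain ⟨B, hB⟩ := (hK.image continuous_subtype_val).bddAbove
  obtain ⟨N, hN⟩ := eventually_atTop.1 (htop.eventually_gt_atTop (B * s))
  rw [Measure.sum_apply _ hK.measurableSet, tsum_eq_sum (s := Finset.range N)]
  · refine ENNReal.sum_lt_top.2 fun k _ => ?_
    rw [Measure.smul_apply, smul_eq_mul]
    exact ENNReal.mul_lt_top (ENNReal.natCast_lt_top _) (measure_lt_top _ _)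
  · intro k hk
    have hk' : N ≤ k := by simpa using hk
    have hnot : (⟨z k / s, div_pos (hpos k) hs⟩ : Ioi (0 : ℝ)) ∉ K := by
      intro hmem
      have h1 : z k / s ≤ B := hB ⟨_, hmem, rfl⟩
      rw [div_le_iff₀ hs] at h1
      exact absurd h1 (not_le.2 (hN k hk'))
    rw [Measure.smul_apply, Measure.dirac_apply' _ hK.measurableSet]
    simp [hnot]

/-- The point process `ν_n = ∑ₖ X k • δ_{z k / z n}` on `(0, ∞)`. -/
noncomputable def scaledProcess {Ω : Type*} (z : ℕ → ℝ) (hpos : ∀ k, 0 < z k)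
    (htop : Tendsto z atTop atTop) (X : ℕ → Ω → ℕ) (n : ℕ) (ω : Ω) :
    LocFinMeasure (Ioi (0 : ℝ)) where
  toMeasure := Measure.sum fun k => (X k ω : ℝ≥0∞) •
    Measure.dirac (⟨z k / z n, div_pos (hpos k) (hpos n)⟩ : Ioi (0 : ℝ))
  finite_on_compacts :=
    isFiniteMeasureOnCompacts_sum_dirac z hpos htop (fun k => X k ω) (hpos n)

/-- The random measures `ξ n` on `(0, ∞)` converge vaguely in distribution to the scale-invariant
Poisson process `η_c`, that is, in distribution as random elements of the space of locally finite
measures with the vague topology. (The law of a Poisson process is determined by its intensity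
measure, so it does not matter which realization `η` of `η_c` is taken.) -/
def ConvergesToScaleInvariantPoisson {Ω : Type*} [MeasurableSpace Ω] (P : Measure Ω)
    [IsProbabilityMeasure P] (ξ : ℕ → Ω → LocFinMeasure (Ioi (0 : ℝ))) (c : ℝ) : Prop :=
  ∃ (Ω' : Type) (_ : MeasurableSpace Ω') (P' : Measure Ω') (_ : IsProbabilityMeasure P')
    (η : Ω' → LocFinMeasure (Ioi (0 : ℝ))),
    IsPoissonProcess η P' (scaleInvariantIntensity c) ∧
      TendstoInDistribution ξ atTop η (fun _ => P) P'

/-- The indices `k` with `a z_n < z_k ≤ b z_n`; a finite set when `z k → ∞`. -/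
def window (z : ℕ → ℝ) (a b : ℝ) (n : ℕ) : Set ℕ :=
  {k | a * z n < z k ∧ z k ≤ b * z n}

/-- The condition on `(q0 k, q1 k) = (P (X k = 0), P (X k = 1))` and `z` with constant `c`. The
lower limit is taken in the extended reals. Under the first clause, `q0 k > 0` for all `k` in
`window z a b n` once `n` is large, so the value of a quotient with denominator zero is
irrelevant. -/
structure WindowCondition (z q0 q1 : ℕ → ℝ) (c : ℝ) : Prop where
  tendsto_prod : ∀ a b : ℝ, 0 < a → a < b →
    Tendsto (fun n => ∏ᶠ k ∈ window z a b n, q0 k) atTop (𝓝 ((a / b) ^ c))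
  le_liminf_sum : ∀ a b : ℝ, 0 < a → a < b →
    ((c * Real.log (b / a) : ℝ) : EReal) ≤
      liminf (fun n => ((∑ᶠ k ∈ window z a b n, q1 k / q0 k : ℝ) : EReal)) atTop

set_option linter.unusedSectionVars false

/-! Write `N` for the mass that `ν_n` gives to `(a, b]` and `l = c log (b / a)` for its mean under
`η_c`. By independence `P(N = 0)` is the product of the `P(X_k = 0)` over the window, and `P(N = 1)`
is this product times the sum of the quotients `P(X_k = 1) / P(X_k = 0)`. So (i) says `P(N = 0) →
exp (-l)`, and given (i), (ii) says `liminf P(N = 1) ≥ l exp (-l)` (`windowCondition_iff`). It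
remains to show that these two statements characterize the convergence.

Sufficiency: cut an interval that carries the test functions into `m` cells of equal intensity `L /
m`. The masses of the cells are independent. A cell has mass outside `{0, 1}` with limiting
probability of order at most `m⁻²`, hence with total probability of order `m⁻¹`. Up to a small error
the random measure is therefore a sum of unit atoms at fixed points of the charged cells
(`abs_integral_pairings_sub_bernoulliMean_le`). The expectation of a functional of this sum is a
polynomial in the void probabilities, which converge. The Poisson process obeys the same estimate,
so the expectations of bounded Lipschitz functions of finitely many integrals converge
(`tendsto_integral_pairings_of_tendsto_increments`). This suffices because the vague topology is
second countable (`tendstoInDistribution_of_tendsto_integral`). A limit on some probability space is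
supplied by `exists_isPoissonProcess`.

Necessity: indicators of intervals are squeezed between continuous bumps, the portmanteau inequality
is applied to open conditions on their integrals, and integrality of the masses turns inequalities
such as `0 < N < 2` into `N = 1`. Continuity of `exp (-l)` and `l exp (-l)` in the end points
removes the loss. -/

namespace LocFinMeasure

/-! ### Integrals of test functions and the vague topology -/

section Integral

variable {S : Type*} [TopologicalSpace S] [MeasurableSpace S]

/-- The integral of a non-negative compactly supported continuous function, as a real number. -/
noncomputable def pairing (f : C_c(S, ℝ≥0)) (μ : LocFinMeasure S) : ℝ :=
  (∫⁻ x, (f x : ℝ≥0∞) ∂μ.toMeasure).toReal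

theorem lintegral_ne_top (f : C_c(S, ℝ≥0)) (μ : LocFinMeasure S) :
    ∫⁻ x, (f x : ℝ≥0∞) ∂μ.toMeasure ≠ ∞ := by
  obtain ⟨C, hC⟩ : ∃ C : ℝ≥0, ∀ x, f x ≤ C := by
    obtain ⟨C, hC⟩ := f.hasCompactSupport.isCompact_range f.continuous |>.bddAbove
    exact ⟨C, fun x => hC ⟨x, rfl⟩⟩
  have hle : ∫⁻ x, (f x : ℝ≥0∞) ∂μ.toMeasure ≤ C * μ.toMeasure (tsupport f) := by
    calc ∫⁻ x, (f x : ℝ≥0∞) ∂μ.toMeasure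
        = ∫⁻ x, (tsupport f).indicator (fun x => (f x : ℝ≥0∞)) x ∂μ.toMeasure := by
          congr 1 with x
          by_cases hx : x ∈ tsupport f
          · rw [indicator_of_mem hx]
          · rw [indicator_of_notMem hx, image_eq_zero_of_notMem_tsupport hx, ENNReal.coe_zero]
      _ ≤ ∫⁻ x in tsupport f, (f x : ℝ≥0∞) ∂μ.toMeasure := lintegral_indicator_le _ _
      _ ≤ ∫⁻ _ in tsupport f, (C : ℝ≥0∞) ∂μ.toMeasure :=
          lintegral_mono fun x => ENNReal.coe_le_coe.2 (hC x)
      _ = C * μ.toMeasure (tsupport f) := setLIntegral_const _ _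
  have := μ.finite_on_compacts
  exact ne_top_of_le_ne_top
    (ENNReal.mul_ne_top ENNReal.coe_ne_top f.hasCompactSupport.isCompact.measure_lt_top.ne) hle

theorem ofReal_pairing (f : C_c(S, ℝ≥0)) (μ : LocFinMeasure S) :
    ENNReal.ofReal (pairing f μ) = ∫⁻ x, (f x : ℝ≥0∞) ∂μ.toMeasure :=
  ENNReal.ofReal_toReal (lintegral_ne_top f μ)

theorem pairing_nonneg (f : C_c(S, ℝ≥0)) (μ : LocFinMeasure S) : 0 ≤ pairing f μ :=
  ENNReal.toReal_nonneg

theorem continuous_lintegral (f : C_c(S, ℝ≥0)) :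
    Continuous fun μ : LocFinMeasure S => ∫⁻ x, (f x : ℝ≥0∞) ∂μ.toMeasure :=
  continuous_iff_le_induced.2 (iInf_le _ f)

theorem continuous_pairing (f : C_c(S, ℝ≥0)) :
    Continuous (pairing f : LocFinMeasure S → ℝ) :=
  continuous_iff_continuousAt.2 fun μ =>
    (ENNReal.tendsto_toReal (lintegral_ne_top f μ)).comp (continuous_lintegral f).continuousAt

/-- The integrals are finite, so `toReal` and `ENNReal.ofReal` translate continuously in both
directions. Real values permit estimates of differences. -/
theorem topology_eq_iInf_induced_pairing :
    (instTopologicalSpace : TopologicalSpace (LocFinMeasure S)) =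
      ⨅ f : C_c(S, ℝ≥0), TopologicalSpace.induced (pairing f) inferInstance := by
  refine le_antisymm (le_iInf fun f => continuous_iff_le_induced.1 (continuous_pairing f)) ?_
  refine le_iInf fun f => (iInf_le _ f).trans ?_
  refine continuous_iff_le_induced.1 ?_
  have h : (fun μ : LocFinMeasure S => ∫⁻ x, (f x : ℝ≥0∞) ∂μ.toMeasure) =
      ENNReal.ofReal ∘ pairing f := funext fun μ => (ofReal_pairing f μ).symm
  rw [h]
  let _ : TopologicalSpace (LocFinMeasure S) := TopologicalSpace.induced (pairing f) inferInstance
  exact ENNReal.continuous_ofReal.comp continuous_induced_dom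

/-- The integrals of finitely many test functions. -/
noncomputable def pairings (I : Finset C_c(S, ℝ≥0)) (μ : LocFinMeasure S) (f : I) : ℝ :=
  pairing (f : C_c(S, ℝ≥0)) μ

theorem continuous_pairings (I : Finset C_c(S, ℝ≥0)) :
    Continuous (pairings I : LocFinMeasure S → I → ℝ) :=
  continuous_pi fun f => continuous_pairing (f : C_c(S, ℝ≥0))

theorem integral_map_map_pairings {Ω : Type*} [MeasurableSpace Ω] {Q : Measure Ω}
    {ζ : Ω → LocFinMeasure S} (hζ : Measurable ζ) (I : Finset C_c(S, ℝ≥0)) {F : (I → ℝ) → ℝ}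
    (hF : Continuous F) :
    ∫ y, F y ∂((Q.map ζ).map (pairings I)) = ∫ ω, F (pairings I (ζ ω)) ∂Q := by
  rw [Measure.map_map (continuous_pairings I).measurable hζ, MeasureTheory.integral_map
    ((continuous_pairings I).measurable.comp hζ).aemeasurable hF.aestronglyMeasurable]
  rfl

theorem exists_pairings_preimage_mem_nhds {u : Set (LocFinMeasure S)} (hu : IsOpen u)
    {μ : LocFinMeasure S} (hμ : μ ∈ u) :
    ∃ (I : Finset C_c(S, ℝ≥0)) (V : Set (I → ℝ)), IsOpen V ∧
      pairings I ⁻¹' V ∈ 𝓝 μ ∧ pairings I ⁻¹' V ⊆ u := by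
  have hb := IsTopologicalBasis.iInf_induced
    (fun _ : C_c(S, ℝ≥0) => TopologicalSpace.isTopologicalBasis_opens (α := ℝ))
    (fun f => (pairing f : LocFinMeasure S → ℝ))
  rw [← topology_eq_iInf_induced_pairing] at hb
  obtain ⟨s, ⟨U, I, hU, rfl⟩, hμs, hsu⟩ := hb.exists_subset_of_mem_open hμ hu
  have hV : IsOpen {y : I → ℝ | ∀ f : I, y f ∈ U f} := by
    rw [ofPred_forall]
    exact isOpen_iInter_of_finite fun f =>
      IsOpen.preimage (continuous_apply f) (hU f f.2 : U f ∈ {s | IsOpen s})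
  refine ⟨I, _, hV, (hV.preimage (continuous_pairings I)).mem_nhds ?_, fun ν hν => hsu ?_⟩
  · intro f
    exact mem_iInter₂.1 hμs f f.2
  · exact mem_iInter₂.2 fun f hf => hν ⟨f, hf⟩

variable [OpensMeasurableSpace S]

/-- Functions that are uniformly close relative to a bump function have close integrals. -/
theorem abs_pairing_sub_le {f h g : C_c(S, ℝ≥0)} {ε : ℝ≥0} (hfh : ∀ x, f x ≤ h x + ε * g x)
    (hhf : ∀ x, h x ≤ f x + ε * g x) (μ : LocFinMeasure S) :
    |pairing f μ - pairing h μ| ≤ ε * pairing g μ := by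
  have key : ∀ f h : C_c(S, ℝ≥0), (∀ x, f x ≤ h x + ε * g x) →
      pairing f μ ≤ pairing h μ + ε * pairing g μ := by
    intro f h hle
    have h1 : ∫⁻ x, (f x : ℝ≥0∞) ∂μ.toMeasure ≤
        ∫⁻ x, (h x : ℝ≥0∞) ∂μ.toMeasure + ε * ∫⁻ x, (g x : ℝ≥0∞) ∂μ.toMeasure := by
      rw [← lintegral_const_mul' _ _ ENNReal.coe_ne_top, ← lintegral_add_left
        (f := fun x => (h x : ℝ≥0∞)) (measurable_coe_nnreal_ennreal.comp h.continuous.measurable)]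
      exact lintegral_mono fun x => by
        simpa only [ENNReal.coe_add, ENNReal.coe_mul] using ENNReal.coe_le_coe.2 (hle x)
    have h2 := ENNReal.toReal_mono (ENNReal.add_ne_top.2 ⟨lintegral_ne_top h μ,
      ENNReal.mul_ne_top ENNReal.coe_ne_top (lintegral_ne_top g μ)⟩) h1
    rwa [ENNReal.toReal_add (lintegral_ne_top h μ)
      (ENNReal.mul_ne_top ENNReal.coe_ne_top (lintegral_ne_top g μ)), ENNReal.toReal_mul] at h2
  rw [abs_le]
  constructor <;> linarith [key f h hfh, key h f hhf]

end Integral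

/-! ### Second countability of the vague topology -/

section SecondCountable

theorem exists_compactlySupported_eq_one {S : Type*} [TopologicalSpace S]
    [LocallyCompactSpace S] [RegularSpace S] {K : Set S} (hK : IsCompact K) {U : Set S}
    (hU : IsOpen U) (hKU : K ⊆ U) :
    ∃ g : C_c(S, ℝ≥0), (∀ x, g x ≤ 1) ∧ (∀ x ∈ K, g x = 1) ∧ ∀ x ∉ U, g x = 0 := by
  obtain ⟨f, hf1, hf0, hfc, hfI⟩ := exists_continuous_one_zero_of_isCompact hK hU.isClosed_compl
    (disjoint_compl_right_iff_subset.2 hKU)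
  refine ⟨⟨⟨fun x => (f x).toNNReal, by fun_prop⟩, ?_⟩, fun x => ?_, fun x hx => ?_, fun x hx => ?_⟩
  · exact hfc.comp_left (g := Real.toNNReal) Real.toNNReal_zero
  · exact Real.toNNReal_le_one.2 (hfI x).2
  · change (f x).toNNReal = 1
    simp [hf1 hx]
  · change (f x).toNNReal = 0
    simp [hf0 hx]

/-- Countably many functions approximate every compactly supported one, uniformly relative to a
bump function from the family. -/
theorem exists_countable_approximating_family {S : Type*} [TopologicalSpace S]
    [SecondCountableTopology S] [LocallyCompactSpace S] [RegularSpace S] :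
    ∃ D : ℕ → ℕ → C_c(S, ℝ≥0), ∃ g : ℕ → C_c(S, ℝ≥0), ∀ f : C_c(S, ℝ≥0), ∃ m, ∀ ε : ℝ≥0, 0 < ε →
      ∃ i, (∀ x, f x ≤ D m i x + ε * g m x) ∧ ∀ x, D m i x ≤ f x + ε * g m x := by
  let K : CompactExhaustion S := default
  have hg : ∀ m, ∃ g : C_c(S, ℝ≥0), ∀ x ∈ K m, g x = 1 := fun m => by
    obtain ⟨g, -, h, -⟩ := exists_compactlySupported_eq_one (K.isCompact m) isOpen_univ
      (subset_univ _)
    exact ⟨g, h⟩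
  choose g hg using hg
  let d : ℕ → C(S, ℝ≥0) := TopologicalSpace.denseSeq C(S, ℝ≥0)
  -- A dense sequence for the compact-open topology is cut off by `g m`. If `K m` contains the
  -- support of `f`, then `f = f * g m`, so an error `ε` on the support of `g m` becomes `ε * g m`
  -- everywhere.
  refine ⟨fun m i => d i • g m, g, fun f => ?_⟩
  obtain ⟨m, hm⟩ := K.exists_superset_of_isCompact f.hasCompactSupport.isCompact
  refine ⟨m, fun ε hε => ?_⟩
  have hd := (TopologicalSpace.denseRange_denseSeq C(S, ℝ≥0)).closure_range
  have hf : (f : C(S, ℝ≥0)) ∈ closure (range d) := by rw [hd]; trivial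
  obtain ⟨u, hu, hlim⟩ := mem_closure_iff_seq_limit.1 hf
  have hunif := ContinuousMap.tendsto_iff_forall_isCompact_tendstoUniformlyOn.1 hlim _
    (g m).hasCompactSupport.isCompact
  obtain ⟨n, hn⟩ := (Metric.tendstoUniformlyOn_iff.1 hunif ε (by exact_mod_cast hε)).exists
  obtain ⟨i, hi⟩ := hu n
  have hfg : ∀ x, f x = f x * g m x := fun x => by
    by_cases hx : x ∈ tsupport f
    · rw [hg m x (hm hx), mul_one]
    · rw [image_eq_zero_of_notMem_tsupport hx, zero_mul]
  have hdist : ∀ x, g m x ≠ 0 → f x ≤ d i x + ε ∧ d i x ≤ f x + ε := fun x hx => by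
    have h1 := hn x (subset_tsupport _ hx)
    rw [← hi, NNReal.dist_eq, abs_lt] at h1
    change -(ε : ℝ) < (f x : ℝ) - d i x ∧ (f x : ℝ) - d i x < ε at h1
    constructor <;> rw [← NNReal.coe_le_coe] <;> push_cast <;> linarith [h1.1, h1.2]
  refine ⟨i, fun x => ?_, fun x => ?_⟩
  all_goals
    rw [hfg x]
    simp only [CompactlySupportedContinuousMap.smulc_apply, smul_eq_mul]
    rw [← add_mul]
    by_cases hx : g m x = 0
    · simp [hx]
    · first
      | exact mul_le_mul_left (hdist x hx).1 _
      | exact mul_le_mul_left (hdist x hx).2 _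

variable {S : Type*} [TopologicalSpace S] [MeasurableSpace S] [OpensMeasurableSpace S]
  [SecondCountableTopology S] [LocallyCompactSpace S] [RegularSpace S]

/-- Countably many pairings already generate the topology: where the pairing with `g m` stays below
its value at `μ` plus one, the pairing with `f` is a uniform limit of pairings with members `D m i`
of the countable family. -/
instance : SecondCountableTopology (LocFinMeasure S) := by
  obtain ⟨D, g, hD⟩ := exists_countable_approximating_family (S := S)
  let φ : (ℕ × ℕ) ⊕ ℕ → C_c(S, ℝ≥0) := Sum.elim (fun p => D p.1 p.2) g
  let t : TopologicalSpace (LocFinMeasure S) :=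
    ⨅ i, TopologicalSpace.induced (pairing (φ i)) inferInstance
  have ht : (instTopologicalSpace : TopologicalSpace (LocFinMeasure S)) = t := by
    refine le_antisymm
      (le_iInf fun i => continuous_iff_le_induced.1 (continuous_pairing (φ i))) ?_
    rw [topology_eq_iInf_induced_pairing]
    refine le_iInf fun f => continuous_iff_le_induced.1 ?_
    have hc : ∀ i, Continuous[t, _] (pairing (φ i)) := fun i =>
      continuous_iff_le_induced.2 (iInf_le _ i)
    obtain ⟨m, hm⟩ := hD f
    let _ := t
    refine continuous_of_locally_uniform_approx_of_continuousAt fun μ u hu => ?_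
    obtain ⟨δ, hδ, hδu⟩ := Metric.mem_uniformity_dist.1 hu
    have hcg : Continuous (pairing (g m)) := hc (Sum.inr m)
    have hpos : 0 < pairing (g m) μ + 1 := by linarith [pairing_nonneg (g m) μ]
    obtain ⟨i, hi1, hi2⟩ := hm (δ / (pairing (g m) μ + 1)).toNNReal
      (Real.toNNReal_pos.2 (div_pos hδ hpos))
    refine ⟨{ν | pairing (g m) ν < pairing (g m) μ + 1},
      (isOpen_lt hcg continuous_const).mem_nhds (by simp), pairing (D m i),
      (hc (Sum.inl (m, i))).continuousAt, fun ν hν => hδu ?_⟩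
    rw [Real.dist_eq]
    refine (abs_pairing_sub_le hi1 hi2 ν).trans_lt ?_
    rw [Real.coe_toNNReal _ (div_pos hδ hpos).le, div_mul_eq_mul_div, div_lt_iff₀ hpos]
    exact mul_lt_mul_of_pos_left hν hδ
  have : @SecondCountableTopology _ t := by
    refine TopologicalSpace.secondCountableTopology_iInf fun i => ?_
    exact TopologicalSpace.secondCountableTopology_induced _ _ _
  rw [ht]
  exact this

end SecondCountable

/-! ### Criteria for measurability and for convergence in distribution -/

section Measurable

variable {S : Type*} [TopologicalSpace S] [MeasurableSpace S] [OpensMeasurableSpace S]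
  [SecondCountableTopology S] [LocallyCompactSpace S] [RegularSpace S]

/-- By second countability the Borel `σ`-algebra is generated by a subbasis, here the preimages of
open sets under single integrals. -/
theorem measurable_of_lintegral {Ω : Type*} [MeasurableSpace Ω] {ξ : Ω → LocFinMeasure S}
    (h : ∀ f : C_c(S, ℝ≥0), Measurable fun ω => ∫⁻ x, (f x : ℝ≥0∞) ∂(ξ ω).toMeasure) :
    Measurable ξ := by
  have hgen : (instTopologicalSpace : TopologicalSpace (LocFinMeasure S)) =
      TopologicalSpace.generateFrom (⋃ f : C_c(S, ℝ≥0), {s | IsOpen[TopologicalSpace.induced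
        (fun μ : LocFinMeasure S => ∫⁻ x, (f x : ℝ≥0∞) ∂μ.toMeasure) inferInstance] s}) := by
    exact (generateFrom_iUnion_isOpen fun f : C_c(S, ℝ≥0) => TopologicalSpace.induced
      (fun μ : LocFinMeasure S => ∫⁻ x, (f x : ℝ≥0∞) ∂μ.toMeasure) inferInstance).symm
  have hb : (instMeasurableSpace : MeasurableSpace (LocFinMeasure S)) = _ :=
    borel_eq_generateFrom_of_subbasis hgen
  rw [hb]
  refine measurable_generateFrom fun s hs => ?_
  obtain ⟨f, hf⟩ := mem_iUnion.1 hs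
  obtain ⟨t, ht, rfl⟩ := isOpen_induced_iff.1 hf
  exact h f ht.measurableSet

/-- Laws on the space of locally finite measures converge weakly as soon as the laws of the
integrals of finitely many test functions do. -/
theorem tendsto_of_tendsto_map_pairings {ι : Type*} {L : Filter ι} [L.IsCountablyGenerated]
    {μs : ι → ProbabilityMeasure (LocFinMeasure S)} {μ : ProbabilityMeasure (LocFinMeasure S)}
    (h : ∀ I : Finset C_c(S, ℝ≥0),
      Tendsto (fun i => (μs i).map (continuous_pairings I).measurable.aemeasurable) L
        (𝓝 (μ.map (continuous_pairings I).measurable.aemeasurable))) :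
    Tendsto μs L (𝓝 μ) := by
  classical
  let C : Set (Set (LocFinMeasure S)) :=
    {s | ∃ (I : Finset C_c(S, ℝ≥0)) (V : Set (I → ℝ)), IsOpen V ∧ s = pairings I ⁻¹' V}
  have hunion : ∀ T : Finset (Set (LocFinMeasure S)), (∀ t ∈ T, t ∈ C) → (⋃ t ∈ T, t) ∈ C := by
    intro T
    induction T using Finset.induction_on with
    | empty => exact fun _ => ⟨∅, ∅, isOpen_empty, by simp⟩
    | insert t T _ ih =>
      intro hT
      obtain ⟨I, V, hV, hIV⟩ := ih fun s hs => hT s (Finset.mem_insert_of_mem hs)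
      obtain ⟨J, W, hW, hJW⟩ := hT t (Finset.mem_insert_self _ _)
      refine ⟨J ∪ I, {y | (fun f : J => y ⟨f, Finset.mem_union_left _ f.2⟩) ∈ W} ∪
        {y | (fun f : I => y ⟨f, Finset.mem_union_right _ f.2⟩) ∈ V},
        (hW.preimage (by fun_prop)).union (hV.preimage (by fun_prop)), ?_⟩
      rw [Finset.set_biUnion_insert, hIV, hJW]
      rfl
  refine tendsto_of_forall_isOpen_le_liminf' fun G hG => ?_
  rcases L.eq_or_neBot with rfl | hL
  · simp
  refine le_of_forall_lt fun r hr => ?_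
  lift r to ℝ≥0 using hr.ne_top
  have hr' : r < μ G := by
    rwa [← ENNReal.coe_lt_coe, ProbabilityMeasure.ennreal_coeFn_eq_coeFn_toMeasure]
  -- Finitely many cylinder sets inside `G` carry almost all of its mass, and their union is again a
  -- cylinder set by `hunion`. Thus the portmanteau inequality for one finite set `I` of test
  -- functions is enough.
  obtain ⟨T, hTC, hTr, hTG⟩ := μ.exists_lt_measure_biUnion_of_isOpen (S := C) (fun u hu x hx => by
    obtain ⟨I, V, hV, h1, h2⟩ := exists_pairings_preimage_mem_nhds hu hx
    exact ⟨_, ⟨I, V, hV, rfl⟩, h1, h2⟩) hG hr'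
  obtain ⟨I, V, hV, hIV⟩ := hunion T hTC
  rw [hIV] at hTr hTG
  have hport := ProbabilityMeasure.le_liminf_measure_open_of_tendsto (h I) hV
  have hmap : ∀ ν : ProbabilityMeasure (LocFinMeasure S),
      (ν.map (continuous_pairings I).measurable.aemeasurable : Measure (I → ℝ)) V =
        (ν : Measure _) (pairings I ⁻¹' V) := fun ν =>
    ProbabilityMeasure.map_apply' _ _ hV.measurableSet
  simp only [hmap] at hport
  calc (r : ℝ≥0∞) < (μ : Measure _) (pairings I ⁻¹' V) := by
        rwa [← ENNReal.coe_lt_coe, ProbabilityMeasure.ennreal_coeFn_eq_coeFn_toMeasure] at hTr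
    _ ≤ _ := hport
    _ ≤ _ := liminf_le_liminf (Eventually.of_forall fun i => measure_mono hTG)

/-- A criterion for convergence in distribution of random measures: convergence of the
expectations of bounded Lipschitz functions of the integrals of finitely many test functions. -/
theorem tendstoInDistribution_of_tendsto_integral {Ω Ω' : Type*} [MeasurableSpace Ω]
    [MeasurableSpace Ω'] {P : Measure Ω} [IsProbabilityMeasure P] {P' : Measure Ω'}
    [IsProbabilityMeasure P'] {ξ : ℕ → Ω → LocFinMeasure S} {η : Ω' → LocFinMeasure S}
    (hξ : ∀ n, Measurable (ξ n)) (hη : Measurable η)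
    (h : ∀ (I : Finset C_c(S, ℝ≥0)) (F : (I → ℝ) → ℝ) (K : ℝ≥0) (C : ℝ), LipschitzWith K F →
      (∀ y, |F y| ≤ C) →
      Tendsto (fun n => ∫ ω, F (pairings I (ξ n ω)) ∂P) atTop
        (𝓝 (∫ ω, F (pairings I (η ω)) ∂P'))) :
    TendstoInDistribution ξ atTop η (fun _ => P) P' where
  forall_aemeasurable n := (hξ n).aemeasurable
  aemeasurable_limit := hη.aemeasurable
  tendsto := by
    refine tendsto_of_tendsto_map_pairings fun I => ?_
    rw [tendsto_iff_forall_lipschitz_integral_tendsto]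
    rintro F ⟨C, hC⟩ ⟨K, hK⟩
    have hF : ∀ y, |F y| ≤ C + |F 0| := fun y => by
      have h1 := hC y 0
      rw [Real.dist_eq] at h1
      linarith [abs_sub_abs_le_abs_sub (F y) (F 0)]
    convert! h I F K _ hK hF using 2 with n
    · exact integral_map_map_pairings (hξ n) I hK.continuous
    · exact integral_map_map_pairings hη I hK.continuous

end Measurable

end LocFinMeasure

/-! ### Random sets of charged cells -/

/-- The expectation of `φ T` for a random set `T` of indices that misses `j` with probability
`p j`, independently for all `j`. -/
noncomputable def bernoulliMean {ι : Type*} [Fintype ι] [DecidableEq ι] (φ : Finset ι → ℝ)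
    (p : ι → ℝ) : ℝ :=
  ∑ T : Finset ι, φ T * ∏ j, if j ∈ T then 1 - p j else p j

/-- A polynomial in `p`. This is how convergence of void probabilities passes to expectations. -/
theorem continuous_bernoulliMean {ι : Type*} [Fintype ι] [DecidableEq ι] (φ : Finset ι → ℝ) :
    Continuous (bernoulliMean φ) := by
  unfold bernoulliMean
  refine continuous_finsetSum _ fun T _ => continuous_const.mul
    (continuous_finsetProd _ fun j _ => ?_)
  split_ifs <;> fun_prop

section Bernoulli

variable {Ω ι : Type*} [MeasurableSpace Ω] {P : Measure Ω} [IsProbabilityMeasure P] [Fintype ι]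
  [DecidableEq ι] {N : ι → Ω → ℝ≥0∞}

theorem integral_indicator_comp {X : Ω → ℝ≥0∞} (hX : AEMeasurable X P) {B : Set ℝ≥0∞}
    (hB : MeasurableSet B) : ∫ ω, B.indicator 1 (X ω) ∂P = P.real (X ⁻¹' B) := by
  rw [← integral_map (f := B.indicator (1 : ℝ≥0∞ → ℝ)) hX
    (measurable_one.indicator hB).aestronglyMeasurable, integral_indicator_one hB, measureReal_def,
    Measure.map_apply_of_aemeasurable hX hB, measureReal_def]

theorem integrable_indicator_comp {X : Ω → ℝ≥0∞} (hX : AEMeasurable X P) {B : Set ℝ≥0∞}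
    (hB : MeasurableSet B) : Integrable (fun ω => B.indicator (1 : ℝ≥0∞ → ℝ) (X ω)) P := by
  refine Integrable.of_bound ((measurable_one.indicator hB).comp_aemeasurable
    hX).aestronglyMeasurable 1 (Eventually.of_forall fun ω => ?_)
  by_cases h : X ω ∈ B <;> simp [h]

theorem measureReal_preimage_ne_zero {X : Ω → ℝ≥0∞} (hX : AEMeasurable X P) :
    P.real (X ⁻¹' {0}ᶜ) = 1 - P.real (X ⁻¹' {0}) := by
  rw [preimage_compl]
  exact probReal_compl_eq_one_sub₀ (hX.nullMeasurableSet_preimage (measurableSet_singleton 0))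

theorem measureReal_preimage_not_zero_one {X : Ω → ℝ≥0∞} (hX : AEMeasurable X P) :
    P.real (X ⁻¹' {0, 1}ᶜ) = 1 - P.real (X ⁻¹' {0}) - P.real (X ⁻¹' {1}) := by
  rw [preimage_compl, probReal_compl_eq_one_sub₀ (hX.nullMeasurableSet_preimage
    ((measurableSet_singleton 1).insert 0)), sub_sub, ← measureReal_union₀
    (hX.nullMeasurableSet_preimage (measurableSet_singleton 1))]
  · rfl
  · refine Disjoint.aedisjoint (Disjoint.preimage _ ?_)
    simp

theorem filter_ne_zero_eq_iff {N : ι → ℝ≥0∞} {T : Finset ι} :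
    (Finset.univ.filter fun j => N j ≠ 0) = T ↔
      ∀ j, N j ∈ (if j ∈ T then {0}ᶜ else {0} : Set ℝ≥0∞) := by
  simp only [Finset.ext_iff, Finset.mem_filter, Finset.mem_univ, true_and]
  refine forall_congr' fun j => ?_
  by_cases hj : j ∈ T <;> simp [hj]

theorem comp_filter_ne_zero_eq_sum (φ : Finset ι → ℝ) (ω : Ω) :
    φ (Finset.univ.filter fun j => N j ω ≠ 0) = ∑ T : Finset ι,
      (⋂ j, N j ⁻¹' (if j ∈ T then {0}ᶜ else {0})).indicator (fun _ => φ T) ω := by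
  rw [Finset.sum_eq_single (Finset.univ.filter fun j => N j ω ≠ 0)]
  · rw [indicator_of_mem]
    exact mem_iInter.2 fun j => filter_ne_zero_eq_iff.1 rfl j
  · intro T _ hT
    rw [indicator_of_notMem]
    exact fun h => hT (filter_ne_zero_eq_iff.2 fun j => mem_iInter.1 h j).symm
  · simp

theorem nullMeasurableSet_iInter_preimage (hN : ∀ j, AEMeasurable (N j) P) (T : Finset ι) :
    NullMeasurableSet (⋂ j, N j ⁻¹' (if j ∈ T then {0}ᶜ else {0})) P := by
  refine NullMeasurableSet.iInter fun j => (hN j).nullMeasurableSet_preimage ?_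
  split_ifs
  exacts [(measurableSet_singleton 0).compl, measurableSet_singleton 0]

theorem integrable_comp_filter_ne_zero (hN : ∀ j, AEMeasurable (N j) P) (φ : Finset ι → ℝ) :
    Integrable (fun ω => φ (Finset.univ.filter fun j => N j ω ≠ 0)) P := by
  simp_rw [comp_filter_ne_zero_eq_sum]
  exact integrable_finsetSum _ fun T _ =>
    (integrable_const _).indicator₀ (nullMeasurableSet_iInter_preimage hN T)

/-- Independence factorizes the probability of each pattern of empty and charged cells. -/
theorem integral_comp_filter_ne_zero (hN : ∀ j, AEMeasurable (N j) P) (hind : iIndepFun N P)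
    (φ : Finset ι → ℝ) :
    ∫ ω, φ (Finset.univ.filter fun j => N j ω ≠ 0) ∂P =
      bernoulliMean φ fun j => P.real (N j ⁻¹' {0}) := by
  simp_rw [comp_filter_ne_zero_eq_sum]
  rw [integral_finsetSum _ fun T _ =>
    (integrable_const _).indicator₀ (nullMeasurableSet_iInter_preimage hN T), bernoulliMean]
  refine Finset.sum_congr rfl fun T _ => ?_
  rw [integral_indicator₀ (nullMeasurableSet_iInter_preimage hN T), setIntegral_const, smul_eq_mul,
    mul_comm]
  congr 1
  have h := hind.measure_inter_preimage_eq_mul Finset.univ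
    (sets := fun j => if j ∈ T then {0}ᶜ else {0}) fun j _ => by
      split_ifs
      exacts [(measurableSet_singleton 0).compl, measurableSet_singleton 0]
  rw [measureReal_def]
  simp only [Finset.mem_univ, iInter_true] at h
  rw [h, ENNReal.toReal_prod]
  refine Finset.prod_congr rfl fun j _ => ?_
  split_ifs
  · exact measureReal_preimage_ne_zero (hN j)
  · rfl

end Bernoulli

/-! ### Replacing a random measure by atoms on a finite partition -/

theorem abs_toReal_setLIntegral_sub_le {S : Type*} [MeasurableSpace S] {μ : Measure S} {A : Set S}
    (hA : MeasurableSet A) (hμ : μ A ≠ ∞) {f : S → ℝ≥0} {c w : ℝ≥0}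
    (hw : ∀ y ∈ A, |(f y : ℝ) - c| ≤ w) :
    |(∫⁻ y in A, (f y : ℝ≥0∞) ∂μ).toReal - c * (μ A).toReal| ≤ w * (μ A).toReal := by
  have h1 : ∫⁻ y in A, (f y : ℝ≥0∞) ∂μ ≤ ((c + w : ℝ≥0) : ℝ≥0∞) * μ A := by
    rw [← setLIntegral_const]
    refine setLIntegral_mono' hA fun y hy => ENNReal.coe_le_coe.2 ?_
    rw [← NNReal.coe_le_coe]
    push_cast
    linarith [abs_le.1 (hw y hy)]
  have h2 : ((c - w : ℝ≥0) : ℝ≥0∞) * μ A ≤ ∫⁻ y in A, (f y : ℝ≥0∞) ∂μ := by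
    rw [← setLIntegral_const]
    refine setLIntegral_mono' hA fun y hy => ENNReal.coe_le_coe.2 ?_
    rw [tsub_le_iff_right, ← NNReal.coe_le_coe]
    push_cast
    linarith [abs_le.1 (hw y hy)]
  have hfin : ((c + w : ℝ≥0) : ℝ≥0∞) * μ A ≠ ∞ := ENNReal.mul_ne_top ENNReal.coe_ne_top hμ
  have h1' := ENNReal.toReal_mono hfin h1
  have h2' := ENNReal.toReal_mono (ne_top_of_le_ne_top hfin h1) h2
  rw [ENNReal.toReal_mul, ENNReal.coe_toReal] at h1' h2'
  push_cast at h1'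
  -- Truncated subtraction dominates the real difference, so the lower bound survives when `c < w`.
  have h3 : ((c : ℝ) - w) ≤ ((c - w : ℝ≥0) : ℝ) := by
    rw [NNReal.coe_sub_def]
    exact le_max_left _ _
  have h4 := mul_le_mul_of_nonneg_right h3 (ENNReal.toReal_nonneg (a := μ A))
  rw [abs_le]
  constructor <;> linarith

namespace LocFinMeasure

variable {S : Type*} [TopologicalSpace S] [MeasurableSpace S] [OpensMeasurableSpace S]
  {ι : Type*} [Fintype ι] [DecidableEq ι]

/-- The values of the test functions on a sum of unit masses at `x j`, `j ∈ T`. -/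
noncomputable def pointSums (I : Finset C_c(S, ℝ≥0)) (x : ι → S) (T : Finset ι) (f : I) : ℝ :=
  ∑ j ∈ T, ((f : C_c(S, ℝ≥0)) (x j) : ℝ)

theorem pairing_eq_sum_setLIntegral {A : ι → Set S} (hA : ∀ j, MeasurableSet (A j))
    (hdisj : Pairwise fun i j => Disjoint (A i) (A j)) {f : C_c(S, ℝ≥0)}
    (hf : ∀ y, f y ≠ 0 → ∃ j, y ∈ A j) {μ : LocFinMeasure S} :
    pairing f μ = ∑ j, (∫⁻ y in A j, (f y : ℝ≥0∞) ∂μ.toMeasure).toReal := by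
  have h : ∫⁻ y, (f y : ℝ≥0∞) ∂μ.toMeasure = ∑ j, ∫⁻ y in A j, (f y : ℝ≥0∞) ∂μ.toMeasure := by
    rw [← tsum_fintype (L := .unconditional ι), ← lintegral_iUnion hA hdisj, ← lintegral_indicator (.iUnion hA)]
    congr 1 with y
    by_cases hy : y ∈ ⋃ j, A j
    · rw [indicator_of_mem hy]
    · rw [indicator_of_notMem hy, ENNReal.coe_eq_zero]
      by_contra hne
      exact hy (mem_iUnion.2 (hf y hne))
  rw [pairing, h, ENNReal.toReal_sum fun j _ =>
    ne_top_of_le_ne_top (lintegral_ne_top f μ) (setLIntegral_le_lintegral _ _)]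

/-- Moving the unit mass of a charged cell to the reference point `x j` changes each integral by at
most `w`. Empty cells contribute nothing. -/
theorem dist_pairings_pointSums_le {A : ι → Set S} (hA : ∀ j, MeasurableSet (A j))
    (hdisj : Pairwise fun i j => Disjoint (A i) (A j)) {I : Finset C_c(S, ℝ≥0)} {x : ι → S}
    {w : ℝ≥0} (hI : ∀ f ∈ I, ∀ y, f y ≠ 0 → ∃ j, y ∈ A j)
    (hw : ∀ f ∈ I, ∀ j, ∀ y ∈ A j, |(f y : ℝ) - f (x j)| ≤ w) {μ : LocFinMeasure S}
    (hμ : ∀ j, μ.toMeasure (A j) = 0 ∨ μ.toMeasure (A j) = 1) :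
    dist (pairings I μ) (pointSums I x (Finset.univ.filter fun j => μ.toMeasure (A j) ≠ 0)) ≤
      w * ∑ j, ({0}ᶜ : Set ℝ≥0∞).indicator (1 : ℝ≥0∞ → ℝ) (μ.toMeasure (A j)) := by
  refine (dist_pi_le_iff (mul_nonneg w.2 (Finset.sum_nonneg fun j _ =>
    indicator_nonneg (fun _ _ => zero_le_one) _))).2 fun f => ?_
  rw [pairings, pointSums, pairing_eq_sum_setLIntegral hA hdisj (hI f f.2), Finset.sum_filter,
    Real.dist_eq, ← Finset.sum_sub_distrib, Finset.mul_sum]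
  refine (Finset.abs_sum_le_sum_abs _ _).trans (Finset.sum_le_sum fun j _ => ?_)
  have hfin : μ.toMeasure (A j) ≠ ∞ := by rcases hμ j with h | h <;> simp [h]
  have := abs_toReal_setLIntegral_sub_le (hA j) hfin (hw f f.2 j)
  rcases hμ j with h | h
  · simpa [h] using this
  · simpa [h] using this

/-- Test functions of a random measure with independent masses on the sets `A j` are close to
Bernoulli means if the masses are mostly `0` or `1` and the test functions vary little on `A j`. -/
theorem abs_integral_pairings_sub_bernoulliMean_le {Ω : Type*} [MeasurableSpace Ω] {P : Measure Ω}
    [IsProbabilityMeasure P] {ξ : Ω → LocFinMeasure S} (hξ : AEMeasurable ξ P) {A : ι → Set S}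
    (hA : ∀ j, MeasurableSet (A j)) (hdisj : Pairwise fun i j => Disjoint (A i) (A j))
    (hN : ∀ j, AEMeasurable (fun ω => (ξ ω).toMeasure (A j)) P)
    (hind : iIndepFun (fun j ω => (ξ ω).toMeasure (A j)) P)
    {I : Finset C_c(S, ℝ≥0)} {x : ι → S} {w : ℝ≥0} (hI : ∀ f ∈ I, ∀ y, f y ≠ 0 → ∃ j, y ∈ A j)
    (hw : ∀ f ∈ I, ∀ j, ∀ y ∈ A j, |(f y : ℝ) - f (x j)| ≤ w) {F : (I → ℝ) → ℝ} {K : ℝ≥0}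
    {C : ℝ} (hF : LipschitzWith K F) (hC : ∀ y, |F y| ≤ C) :
    |∫ ω, F (pairings I (ξ ω)) ∂P - bernoulliMean (fun T => F (pointSums I x T))
      (fun j => P.real ((fun ω => (ξ ω).toMeasure (A j)) ⁻¹' {0}))| ≤
    K * w * ∑ j, (1 - P.real ((fun ω => (ξ ω).toMeasure (A j)) ⁻¹' {0})) +
    2 * C * ∑ j, (1 - P.real ((fun ω => (ξ ω).toMeasure (A j)) ⁻¹' {0}) -
      P.real ((fun ω => (ξ ω).toMeasure (A j)) ⁻¹' {1})) := by
  have hC0 : 0 ≤ C := (abs_nonneg _).trans (hC 0)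
  have hB1 : MeasurableSet ({0}ᶜ : Set ℝ≥0∞) := (measurableSet_singleton 0).compl
  have hB2 : MeasurableSet ({0, 1}ᶜ : Set ℝ≥0∞) := ((measurableSet_singleton 1).insert 0).compl
  let G : Finset ι → ℝ := fun T => F (pointSums I x T)
  have hpt : ∀ ω, |F (pairings I (ξ ω)) -
      G (Finset.univ.filter fun j => (ξ ω).toMeasure (A j) ≠ 0)| ≤
      K * w * ∑ j, ({0}ᶜ : Set ℝ≥0∞).indicator (1 : ℝ≥0∞ → ℝ) ((ξ ω).toMeasure (A j)) +
      2 * C * ∑ j, ({0, 1}ᶜ : Set ℝ≥0∞).indicator (1 : ℝ≥0∞ → ℝ) ((ξ ω).toMeasure (A j)) := by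
    intro ω
    have hn1 : 0 ≤ ∑ j, ({0}ᶜ : Set ℝ≥0∞).indicator (1 : ℝ≥0∞ → ℝ) ((ξ ω).toMeasure (A j)) :=
      Finset.sum_nonneg fun j _ => indicator_nonneg (fun _ _ => zero_le_one) _
    have hn2 : ∀ j, 0 ≤ ({0, 1}ᶜ : Set ℝ≥0∞).indicator (1 : ℝ≥0∞ → ℝ) ((ξ ω).toMeasure (A j)) :=
      fun j => indicator_nonneg (fun _ _ => zero_le_one) _
    -- If all masses are `0` or `1`, the Lipschitz bound gives the first sum. Otherwise the second
    -- sum is at least one, and the trivial bound `2 * C` suffices.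
    by_cases h : ∀ j, (ξ ω).toMeasure (A j) = 0 ∨ (ξ ω).toMeasure (A j) = 1
    · have h1 := hF.dist_le_mul (pairings I (ξ ω))
        (pointSums I x (Finset.univ.filter fun j => (ξ ω).toMeasure (A j) ≠ 0))
      rw [Real.dist_eq] at h1
      refine h1.trans (le_add_of_le_of_nonneg ?_ (mul_nonneg (by positivity)
        (Finset.sum_nonneg fun j _ => hn2 j)))
      rw [mul_assoc]
      exact mul_le_mul_of_nonneg_left (dist_pairings_pointSums_le hA hdisj hI hw h) K.2
    · push Not at h
      obtain ⟨j, hj⟩ := h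
      have h1 : (1 : ℝ) ≤ ∑ j, ({0, 1}ᶜ : Set ℝ≥0∞).indicator (1 : ℝ≥0∞ → ℝ)
          ((ξ ω).toMeasure (A j)) := by
        refine le_trans ?_ (Finset.single_le_sum (fun j _ => hn2 j) (Finset.mem_univ j))
        rw [indicator_of_mem (by simp [hj.1, hj.2])]
        rfl
      have h2 : |F (pairings I (ξ ω)) -
          G (Finset.univ.filter fun j => (ξ ω).toMeasure (A j) ≠ 0)| ≤ 2 * C := by
        refine (abs_sub _ _).trans ?_
        linarith [hC (pairings I (ξ ω)),
          hC (pointSums I x (Finset.univ.filter fun j => (ξ ω).toMeasure (A j) ≠ 0))]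
      have h3 : 0 ≤ K * w * ∑ j, ({0}ᶜ : Set ℝ≥0∞).indicator (1 : ℝ≥0∞ → ℝ)
        ((ξ ω).toMeasure (A j)) := mul_nonneg (by positivity) hn1
      nlinarith
  have hint : Integrable (fun ω => F (pairings I (ξ ω))) P :=
    Integrable.of_bound ((hF.continuous.measurable.comp
      (continuous_pairings I).measurable).comp_aemeasurable hξ).aestronglyMeasurable C
      (Eventually.of_forall fun ω => hC _)
  rw [← integral_comp_filter_ne_zero hN hind G, ← integral_sub hint
    (integrable_comp_filter_ne_zero hN G)]
  refine (abs_integral_le_integral_abs).trans ?_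
  refine (integral_mono (hint.sub (integrable_comp_filter_ne_zero hN G)).abs ?_ hpt).trans ?_
  · exact ((integrable_finsetSum _ fun j _ => integrable_indicator_comp (hN j) hB1).const_mul _).add
      ((integrable_finsetSum _ fun j _ => integrable_indicator_comp (hN j) hB2).const_mul _)
  · rw [integral_add ((integrable_finsetSum _ fun j _ =>
        integrable_indicator_comp (hN j) hB1).const_mul _)
      ((integrable_finsetSum _ fun j _ => integrable_indicator_comp (hN j) hB2).const_mul _),
      integral_const_mul, integral_const_mul,
      integral_finsetSum _ fun j _ => integrable_indicator_comp (hN j) hB1,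
      integral_finsetSum _ fun j _ => integrable_indicator_comp (hN j) hB2]
    refine le_of_eq ?_
    congr 3 <;> ext j
    · rw [integral_indicator_comp (hN j) hB1, measureReal_preimage_ne_zero (hN j)]
    · rw [integral_indicator_comp (hN j) hB2, measureReal_preimage_not_zero_one (hN j)]

end LocFinMeasure

/-! ### Intervals and geometric partitions of the half-line -/

/-- The interval `(a, b]` as a subset of `(0, ∞)`. -/
def subIoc (a b : ℝ) : Set (Ioi (0 : ℝ)) := Subtype.val ⁻¹' Ioc a b

theorem mem_subIoc {a b : ℝ} {y : Ioi (0 : ℝ)} : y ∈ subIoc a b ↔ a < (y : ℝ) ∧ (y : ℝ) ≤ b :=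
  Iff.rfl

theorem measurableSet_subIoc (a b : ℝ) : MeasurableSet (subIoc a b) :=
  measurable_subtype_coe measurableSet_Ioc

theorem pairwise_disjoint_subIoc_succ {t : ℕ → ℝ} (ht : Monotone t) (m : ℕ) :
    Pairwise fun i j : Fin m => Disjoint (subIoc (t i) (t (i + 1))) (subIoc (t j) (t (j + 1))) :=
  fun _ _ hij => (ht.pairwise_disjoint_on_Ioc_succ fun h => hij (Fin.ext h)).preimage _

theorem scaleInvariantIntensity_subIoc {c a b : ℝ} (hc : 0 ≤ c) (ha : 0 < a) (hab : a ≤ b) :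
    scaleInvariantIntensity c (subIoc a b) = ENNReal.ofReal (c * Real.log (b / a)) := by
  have himg : Subtype.val '' subIoc a b = Ioc a b := by
    rw [subIoc, Subtype.image_preimage_coe, inter_eq_right]
    exact fun x hx => ha.trans hx.1
  rw [scaleInvariantIntensity, withDensity_apply _ (measurableSet_subIoc a b),
    setLIntegral_subtype measurableSet_Ioi _ fun t : ℝ => ENNReal.ofReal (c * t⁻¹), himg,
    ← ofReal_integral_eq_lintegral_ofReal, ← intervalIntegral.integral_of_le hab,
    intervalIntegral.integral_const_mul, integral_inv_of_pos ha (ha.trans_le hab)]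
  · have h : IntervalIntegrable (fun t : ℝ => c * t⁻¹) volume a b := by
      refine (intervalIntegral.intervalIntegrable_inv (fun x hx => ?_) continuousOn_id).const_mul c
      rw [uIcc_of_le hab] at hx
      exact (ha.trans_le hx.1).ne'
    exact (intervalIntegrable_iff_integrableOn_Ioc_of_le hab).1 h
  · refine (ae_restrict_iff' measurableSet_Ioc).2 (Eventually.of_forall fun x hx => ?_)
    exact mul_nonneg hc (inv_nonneg.2 (ha.trans hx.1).le)

theorem exists_subIoc_superset {K : Set (Ioi (0 : ℝ))} (hK : IsCompact K) :
    ∃ a b : ℝ, 0 < a ∧ a < b ∧ K ⊆ subIoc a b := by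
  have hK' := hK.image continuous_subtype_val
  rcases K.eq_empty_or_nonempty with rfl | hne
  · exact ⟨1, 2, one_pos, one_lt_two, empty_subset _⟩
  obtain ⟨u, ⟨u, hu, rfl⟩, hmin⟩ := hK'.exists_isLeast (hne.image _)
  obtain ⟨v, ⟨v, hv, rfl⟩, hmax⟩ := hK'.exists_isGreatest (hne.image _)
  have hu0 : (0 : ℝ) < u := u.2
  -- The interval is open on the left, so its left end must lie strictly below the minimum `u`.
  refine ⟨u / 2, v, half_pos hu0, (half_lt_self hu0).trans_le (hmax ⟨u, hu, rfl⟩), fun y hy => ?_⟩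
  exact ⟨(half_lt_self hu0).trans_le (hmin ⟨y, hy, rfl⟩), hmax ⟨y, hy, rfl⟩⟩

theorem exists_subIoc_superset_of_finset (I : Finset C_c(Ioi (0 : ℝ), ℝ≥0)) :
    ∃ a b : ℝ, 0 < a ∧ a < b ∧ ∀ f ∈ I, ∀ y, f y ≠ 0 → y ∈ subIoc a b := by
  obtain ⟨a, b, ha, hab, h⟩ := exists_subIoc_superset
    (I.isCompact_biUnion fun f _ => f.hasCompactSupport.isCompact)
  exact ⟨a, b, ha, hab, fun f hf y hy => h (mem_iUnion₂.2 ⟨f, hf, subset_tsupport _ hy⟩)⟩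

theorem exists_uniform_modulus (I : Finset C_c(Ioi (0 : ℝ), ℝ≥0)) {w : ℝ} (hw : 0 < w) :
    ∃ δ > 0, ∀ f ∈ I, ∀ x y : Ioi (0 : ℝ), |(x : ℝ) - y| < δ → |(f x : ℝ) - f y| ≤ w := by
  classical
  induction I using Finset.induction_on with
  | empty => exact ⟨1, one_pos, by simp⟩
  | insert f I _ ih =>
    obtain ⟨δ, hδ, h⟩ := ih
    have huc : UniformContinuous f := f.hasCompactSupport.uniformContinuous_of_continuous f.continuous
    obtain ⟨δ', hδ', h'⟩ := Metric.uniformContinuous_iff.1 huc w hw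
    refine ⟨min δ δ', lt_min hδ hδ', fun g hg x y hxy => ?_⟩
    rcases Finset.mem_insert.1 hg with rfl | hg
    · exact (h' (hxy.trans_le (min_le_right _ _))).le
    · exact h g hg x y (hxy.trans_le (min_le_left _ _))

/-- The points that divide `(a, b]` into `m` intervals of the same scale invariant length. -/
noncomputable def geomPartition (a b : ℝ) (m j : ℕ) : ℝ :=
  a * Real.exp (j * (Real.log (b / a) / m))

section geomPartition

variable {a b : ℝ} (ha : 0 < a) (hab : a < b) {m : ℕ} (hm : m ≠ 0)
include ha

theorem geomPartition_pos (j : ℕ) : 0 < geomPartition a b m j :=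
  mul_pos ha (Real.exp_pos _)

include hab

theorem log_div_pos : 0 < Real.log (b / a) :=
  Real.log_pos ((one_lt_div ha).2 hab)

theorem monotone_geomPartition : Monotone (geomPartition a b m) := by
  intro i j hij
  have := (log_div_pos ha hab).le
  unfold geomPartition
  gcongr

theorem geomPartition_succ_div (j : ℕ) :
    geomPartition a b m (j + 1) / geomPartition a b m j = Real.exp (Real.log (b / a) / m) := by
  rw [div_eq_iff (geomPartition_pos ha j).ne', geomPartition, geomPartition, mul_left_comm,
    ← Real.exp_add]
  push_cast
  ring_nf

include hm

theorem geomPartition_lt_succ (j : ℕ) : geomPartition a b m j < geomPartition a b m (j + 1) := by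
  rw [← one_lt_div (geomPartition_pos ha j), geomPartition_succ_div ha hab, Real.one_lt_exp_iff]
  exact div_pos (log_div_pos ha hab) (by positivity)

theorem geomPartition_self : geomPartition a b m m = b := by
  rw [geomPartition, mul_div_cancel₀ _ (by exact_mod_cast hm), Real.exp_log
    (div_pos (ha.trans hab) ha), mul_div_cancel₀ _ ha.ne']

theorem exists_mem_subIoc_geomPartition {y : Ioi (0 : ℝ)} (hy : y ∈ subIoc a b) :
    ∃ j : Fin m, y ∈ subIoc (geomPartition a b m j) (geomPartition a b m (j + 1)) := by
  have h := (monotone_geomPartition ha hab (m := m)).biUnion_Ico_Ioc_map_succ 0 m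
  rw [geomPartition_self ha hab hm] at h
  have h0 : geomPartition a b m 0 = a := by simp [geomPartition]
  rw [h0] at h
  have hy' : (y : ℝ) ∈ Ioc a b := hy
  rw [← h] at hy'
  obtain ⟨j, hj, hyj⟩ := mem_iUnion₂.1 hy'
  exact ⟨⟨j, hj.2⟩, hyj⟩

/-- Consecutive points have a fixed ratio, so a cell has length (ratio minus one) times its left
end, which is at most `b`. Hence the mesh tends to zero as `m` grows. -/
theorem geomPartition_succ_sub_le (j : Fin m) :
    geomPartition a b m (j + 1) - geomPartition a b m j ≤
      b * (Real.exp (Real.log (b / a) / m) - 1) := by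
  have h1 := geomPartition_succ_div ha hab (m := m) j
  rw [div_eq_iff (geomPartition_pos ha _).ne'] at h1
  have h2 : geomPartition a b m j ≤ b := by
    conv_rhs => rw [← geomPartition_self ha hab hm]
    exact monotone_geomPartition ha hab j.2.le
  have h3 : 1 ≤ Real.exp (Real.log (b / a) / m) :=
    Real.one_le_exp (div_nonneg (log_div_pos ha hab).le (by positivity))
  nlinarith

end geomPartition

theorem tendsto_mul_exp_div_sub_one (b L : ℝ) :
    Tendsto (fun m : ℕ => b * (Real.exp (L / m) - 1)) atTop (𝓝 0) := by
  have h1 : Tendsto (fun m : ℕ => L / m) atTop (𝓝 0) := tendsto_const_div_atTop_nhds_zero_nat L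
  have h2 := ((Real.continuous_exp.tendsto 0).comp h1).sub_const 1 |>.const_mul b
  simpa using h2

/-! ### Probabilities of the values of a Poisson process -/

namespace IsPoissonProcess

variable {Ω S : Type*} [MeasurableSpace Ω] [TopologicalSpace S] [MeasurableSpace S]
  {η : Ω → LocFinMeasure S} {P : Measure Ω} {μ : Measure S}

/-- `Measure.map` is zero for a map that is not a.e. measurable, whereas `map_eq` exhibits a
probability measure. -/
theorem aemeasurable_apply (hη : IsPoissonProcess η P μ) {A : Set S} (hA : MeasurableSet A)
    (hμ : μ A ≠ ∞) : AEMeasurable (fun ω => (η ω).toMeasure A) P := by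
  refine AEMeasurable.of_map_ne_zero ?_
  rw [hη.map_eq A hA hμ]
  exact IsProbabilityMeasure.ne_zero _

theorem measureReal_apply_eq (hη : IsPoissonProcess η P μ) {A : Set S} (hA : MeasurableSet A)
    {l : ℝ} (hl : 0 ≤ l) (hμ : μ A = ENNReal.ofReal l) (n : ℕ) :
    P.real ((fun ω => (η ω).toMeasure A) ⁻¹' {(n : ℝ≥0∞)}) =
      Real.exp (-l) * l ^ n / n.factorial := by
  have hfin : μ A ≠ ∞ := by simp [hμ]
  rw [measureReal_def, ← Measure.map_apply_of_aemeasurable (hη.aemeasurable_apply hA hfin)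
    (measurableSet_singleton _), hη.map_eq A hA hfin, Measure.map_apply (measurable_of_countable _)
    (measurableSet_singleton _)]
  have : (fun m : ℕ => (m : ℝ≥0∞)) ⁻¹' {(n : ℝ≥0∞)} = {n} := by
    ext m
    simp
  rw [this, ← measureReal_def, poissonMeasure_real_singleton, hμ, ENNReal.ofReal, ENNReal.toNNReal_coe,
    Real.coe_toNNReal _ hl]

theorem measureReal_apply_eq_zero (hη : IsPoissonProcess η P μ) {A : Set S} (hA : MeasurableSet A)
    {l : ℝ} (hl : 0 ≤ l) (hμ : μ A = ENNReal.ofReal l) :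
    P.real ((fun ω => (η ω).toMeasure A) ⁻¹' {0}) = Real.exp (-l) := by
  simpa using hη.measureReal_apply_eq hA hl hμ 0

theorem measureReal_apply_eq_one (hη : IsPoissonProcess η P μ) {A : Set S} (hA : MeasurableSet A)
    {l : ℝ} (hl : 0 ≤ l) (hμ : μ A = ENNReal.ofReal l) :
    P.real ((fun ω => (η ω).toMeasure A) ⁻¹' {1}) = Real.exp (-l) * l := by
  simpa using hη.measureReal_apply_eq hA hl hμ 1

end IsPoissonProcess

/-! ### Sufficiency: from increments to test functions -/

open LocFinMeasure

/-- Test functions of random measures on `(0, ∞)` with independent increments converge to those of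
the scale-invariant Poisson process if the probabilities of the values `0` and `1` of the
increments have the right limits. -/
theorem tendsto_integral_pairings_of_tendsto_increments {Ω Ω' : Type*} [MeasurableSpace Ω]
    [MeasurableSpace Ω'] {P : Measure Ω} [IsProbabilityMeasure P] {P' : Measure Ω'}
    [IsProbabilityMeasure P'] {ξ : ℕ → Ω → LocFinMeasure (Ioi (0 : ℝ))}
    {η : Ω' → LocFinMeasure (Ioi (0 : ℝ))} {c : ℝ} (hc : 0 < c)
    (hη : IsPoissonProcess η P' (scaleInvariantIntensity c))
    (hξ : ∀ n, Measurable (ξ n))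
    (hξm : ∀ n a b, 0 < a → a < b → AEMeasurable (fun ω => (ξ n ω).toMeasure (subIoc a b)) P)
    (hind : ∀ n m (t : ℕ → ℝ), 0 < t 0 → Monotone t →
      iIndepFun (fun (j : Fin m) ω => (ξ n ω).toMeasure (subIoc (t j) (t (j + 1)))) P)
    (h0 : ∀ a b, 0 < a → a < b →
      Tendsto (fun n => P.real ((fun ω => (ξ n ω).toMeasure (subIoc a b)) ⁻¹' {0})) atTop
        (𝓝 (Real.exp (-(c * Real.log (b / a))))))
    (h1 : ∀ a b, 0 < a → a < b →
      ∀ r < Real.exp (-(c * Real.log (b / a))) * (c * Real.log (b / a)),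
      ∀ᶠ n in atTop, r < P.real ((fun ω => (ξ n ω).toMeasure (subIoc a b)) ⁻¹' {1}))
    (I : Finset C_c(Ioi (0 : ℝ), ℝ≥0)) {F : (I → ℝ) → ℝ} {K : ℝ≥0} {C : ℝ}
    (hF : LipschitzWith K F) (hC : ∀ y, |F y| ≤ C) :
    Tendsto (fun n => ∫ ω, F (pairings I (ξ n ω)) ∂P) atTop
      (𝓝 (∫ ω, F (pairings I (η ω)) ∂P')) := by
  have hC0 : 0 ≤ C := (abs_nonneg _).trans (hC 0)
  obtain ⟨a, b, ha, hab, hI⟩ := exists_subIoc_superset_of_finset I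
  set L : ℝ := c * Real.log (b / a) with hL
  have hLpos : 0 < L := mul_pos hc (log_div_pos ha hab)
  refine Metric.tendsto_atTop'.2 fun ε hε => ?_
  obtain ⟨w, hw, hwε⟩ : ∃ w : ℝ≥0, 0 < w ∧ K * w * (L + 1) ≤ ε / 8 := by
    refine ⟨(ε / 8 / ((K + 1) * (L + 1))).toNNReal, Real.toNNReal_pos.2 (by positivity), ?_⟩
    rw [Real.coe_toNNReal _ (by positivity)]
    have : (K : ℝ) * (ε / 8 / ((K + 1) * (L + 1))) * (L + 1) = ε / 8 * (K / (K + 1)) := by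
      field_simp
    rw [this]
    exact mul_le_of_le_one_right (by positivity) ((div_le_one (by positivity)).2 (by linarith))
  obtain ⟨δ, hδ, hmod⟩ := exists_uniform_modulus I (w := w) (by exact_mod_cast hw)
  -- The first bound makes the cells finer than the modulus of continuity `δ`. The second controls
  -- masses outside `{0, 1}`: `m` cells, each with probability at most `(L ^ 2 + 1) / m ^ 2`.
  obtain ⟨m, hm, hmδ, hmε⟩ : ∃ m : ℕ, m ≠ 0 ∧
      b * (Real.exp (Real.log (b / a) / m) - 1) < δ ∧ 2 * C * ((L ^ 2 + 1) / m) ≤ ε / 8 := by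
    have e1 := (tendsto_mul_exp_div_sub_one b (Real.log (b / a))).eventually (gt_mem_nhds hδ)
    have e2 : Tendsto (fun m : ℕ => 2 * C * ((L ^ 2 + 1) / m)) atTop (𝓝 0) := by
      simpa using (tendsto_const_div_atTop_nhds_zero_nat (L ^ 2 + 1)).const_mul (2 * C)
    have e3 := e2.eventually (gt_mem_nhds (show (0 : ℝ) < ε / 8 by positivity))
    obtain ⟨m, h⟩ := ((eventually_ne_atTop 0).and (e1.and e3)).exists
    exact ⟨m, h.1, h.2.1, h.2.2.le⟩
  have hm0 : (0 : ℝ) < m := by positivity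
  set t : ℕ → ℝ := geomPartition a b m with ht
  have htpos : ∀ j, 0 < t j := geomPartition_pos ha
  have htlt : ∀ j, t j < t (j + 1) := geomPartition_lt_succ ha hab hm
  have hmono : Monotone t := monotone_geomPartition ha hab
  have hlen : ∀ j, c * Real.log (t (j + 1) / t j) = L / m := fun j => by
    rw [geomPartition_succ_div ha hab, Real.log_exp, hL, mul_div_assoc]
  set l : ℝ := L / m with hl
  have hlpos : 0 < l := by positivity
  let A : Fin m → Set (Ioi (0 : ℝ)) := fun j => subIoc (t j) (t (j + 1))
  have hA : ∀ j, MeasurableSet (A j) := fun j => measurableSet_subIoc _ _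
  have hdisj : Pairwise fun i j => Disjoint (A i) (A j) := pairwise_disjoint_subIoc_succ hmono m
  let x : Fin m → Ioi (0 : ℝ) := fun j => ⟨t (j + 1), htpos _⟩
  have hIA : ∀ f ∈ I, ∀ y, f y ≠ 0 → ∃ j, y ∈ A j := fun f hf y hy =>
    exists_mem_subIoc_geomPartition ha hab hm (hI f hf y hy)
  have hwA : ∀ f ∈ I, ∀ j, ∀ y ∈ A j, |(f y : ℝ) - f (x j)| ≤ w := by
    intro f hf j y hy
    refine hmod f hf y (x j) (lt_of_le_of_lt ?_ hmδ)
    refine le_trans ?_ (geomPartition_succ_sub_le ha hab hm j)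
    have h2 : (y : ℝ) ≤ t (j + 1) := hy.2
    have h3 : t j < y := hy.1
    rw [abs_sub_comm, abs_of_nonneg (sub_nonneg.2 h2)]
    exact sub_le_sub_left h3.le _
  have hμA : ∀ j, scaleInvariantIntensity c (A j) = ENNReal.ofReal l := fun j => by
    rw [scaleInvariantIntensity_subIoc hc.le (htpos _) (htlt _).le, hlen]
  have hμfin : ∀ j, scaleInvariantIntensity c (A j) ≠ ∞ := fun j => by simp [hμA]
  let H : (Fin m → ℝ) → ℝ := bernoulliMean fun T => F (pointSums I x T)
  -- For a Poisson cell this gives `1 - exp (-l) ≤ l` and `1 - (1 + l) exp (-l) ≤ 1 - (1 + l) (1 -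
  -- l) = l ^ 2`.
  have hexp : 1 - l ≤ Real.exp (-l) := by linarith [Real.add_one_le_exp (-l)]
  -- The slacks `1 / m` and `1 / m ^ 2` leave room for the convergence in `n`; the limit itself
  -- needs none.
  have key : ∀ p0 p1 : Fin m → ℝ, (∀ j, 1 - p0 j ≤ l + 1 / m) →
      (∀ j, 1 - p0 j - p1 j ≤ l ^ 2 + 1 / m ^ 2) →
      K * w * ∑ j, (1 - p0 j) + 2 * C * ∑ j, (1 - p0 j - p1 j) ≤ ε / 4 := by
    intro p0 p1 hp0 hp1
    have s1 : ∑ j, (1 - p0 j) ≤ L + 1 := by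
      refine (Finset.sum_le_sum fun j _ => hp0 j).trans (le_of_eq ?_)
      rw [Finset.sum_const, Finset.card_univ, Fintype.card_fin, nsmul_eq_mul, hl]
      field_simp
    have s2 : ∑ j, (1 - p0 j - p1 j) ≤ (L ^ 2 + 1) / m := by
      refine (Finset.sum_le_sum fun j _ => hp1 j).trans (le_of_eq ?_)
      rw [Finset.sum_const, Finset.card_univ, Fintype.card_fin, nsmul_eq_mul, hl]
      field_simp
    have := mul_le_mul_of_nonneg_left s1 (show (0 : ℝ) ≤ K * w by positivity)
    have := mul_le_mul_of_nonneg_left s2 (show (0 : ℝ) ≤ 2 * C by positivity)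
    linarith
  have hlim : |∫ ω, F (pairings I (η ω)) ∂P' - H fun _ => Real.exp (-l)| ≤ ε / 4 := by
    have h := abs_integral_pairings_sub_bernoulliMean_le hη.measurable.aemeasurable hA hdisj
      (fun j => hη.aemeasurable_apply (hA j) (hμfin j)) (hη.indep m A hA hμfin hdisj) hIA hwA hF hC
    simp only [fun j => hη.measureReal_apply_eq_zero (hA j) hlpos.le (hμA j),
      fun j => hη.measureReal_apply_eq_one (hA j) hlpos.le (hμA j)] at h
    refine h.trans (key (fun _ => Real.exp (-l)) (fun _ => Real.exp (-l) * l) (fun j => ?_)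
      fun j => ?_)
    · have : (0 : ℝ) ≤ 1 / m := by positivity
      linarith
    · have : (0 : ℝ) ≤ 1 / m ^ 2 := by positivity
      nlinarith
  have hp0 : ∀ j : Fin m, Tendsto (fun n => P.real ((fun ω => (ξ n ω).toMeasure (A j)) ⁻¹' {0}))
      atTop (𝓝 (Real.exp (-l))) := fun j => by
    have := h0 _ _ (htpos j) (htlt j)
    rwa [hlen] at this
  have hp1 : ∀ j : Fin m, ∀ r < Real.exp (-l) * l,
      ∀ᶠ n in atTop, r < P.real ((fun ω => (ξ n ω).toMeasure (A j)) ⁻¹' {1}) := fun j => by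
    have := h1 _ _ (htpos j) (htlt j)
    rwa [hlen] at this
  -- Only void probabilities enter `H`. The probabilities of the value `1` are needed merely from
  -- below, to bound those of values outside `{0, 1}`.
  have hHlim : Tendsto (fun n => H fun j =>
      P.real ((fun ω => (ξ n ω).toMeasure (A j)) ⁻¹' {0})) atTop
      (𝓝 (H fun _ => Real.exp (-l))) :=
    ((continuous_bernoulliMean _).tendsto _).comp (tendsto_pi_nhds.2 hp0)
  have e1 := hHlim.eventually (Metric.ball_mem_nhds _ (show (0 : ℝ) < ε / 4 by positivity))
  have e2 : ∀ᶠ n in atTop, ∀ j : Fin m,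
      1 - P.real ((fun ω => (ξ n ω).toMeasure (A j)) ⁻¹' {0}) ≤ l + 1 / m :=
    eventually_all.2 fun j => by
      have hpos : (0 : ℝ) < 1 / m := by positivity
      filter_upwards [(hp0 j).eventually (lt_mem_nhds (show Real.exp (-l) - 1 / m < _ by linarith))]
        with n hn
      linarith
  have e3 : ∀ᶠ n in atTop, ∀ j : Fin m,
      1 - P.real ((fun ω => (ξ n ω).toMeasure (A j)) ⁻¹' {0}) -
        P.real ((fun ω => (ξ n ω).toMeasure (A j)) ⁻¹' {1}) ≤ l ^ 2 + 1 / m ^ 2 :=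
    eventually_all.2 fun j => by
      have hpos : (0 : ℝ) < 1 / m ^ 2 / 2 := by positivity
      filter_upwards [(hp0 j).eventually
        (lt_mem_nhds (show Real.exp (-l) - 1 / m ^ 2 / 2 < _ by linarith)),
        hp1 j (Real.exp (-l) * l - 1 / m ^ 2 / 2) (by linarith)] with n hn hn'
      nlinarith
  obtain ⟨n₀, hn₀⟩ := eventually_atTop.1 (e1.and (e2.and e3))
  refine ⟨n₀, fun n hn => ?_⟩
  obtain ⟨d1, d2, d3⟩ := hn₀ n hn.le
  have h := (abs_integral_pairings_sub_bernoulliMean_le (hξ n).aemeasurable hA hdisj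
    (fun j => hξm n _ _ (htpos j) (htlt j)) (hind n m t (htpos 0) hmono) hIA hwA hF hC).trans
    (key _ _ d2 d3)
  rw [Real.dist_eq] at d1 ⊢
  change |_ - H _| ≤ _ at h
  have t1 := abs_le.1 h
  have t2 := abs_lt.1 d1
  have t3 := abs_le.1 hlim
  rw [abs_lt]
  constructor <;> linarith [t1.1, t1.2, t2.1, t2.2, t3.1, t3.2]

/-! ### Sums over blocks of independent variables -/

section Blocks

variable {Ω : Type*} [MeasurableSpace Ω] {P : Measure Ω}

/-- Functions of disjoint blocks of independent random variables are independent. -/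
theorem iIndepFun_finset_blocks [IsProbabilityMeasure P] {κ ι β γ : Type*} [MeasurableSpace β]
    [MeasurableSpace γ] {X : κ → Ω → β} (hX : iIndepFun X P) (hXm : ∀ k, Measurable (X k))
    {W : ι → Finset κ} (hW : Pairwise fun i j => Disjoint (W i) (W j))
    {g : ∀ j, (W j → β) → γ} (hg : ∀ j, Measurable (g j)) :
    iIndepFun (fun j ω => g j fun k => X k ω) P := by
  classical
  rw [iIndepFun_iff_measure_inter_preimage_eq_mul]
  intro s
  induction s using Finset.induction_on with
  | empty => simp
  | insert i s hi ih =>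
    intro B hB
    rw [Finset.set_biInter_insert, Finset.prod_insert hi,
      ← ih fun j hj => hB j (Finset.mem_insert_of_mem hj)]
    -- The events of the blocks in `s` depend only on coordinates in `U`, which is disjoint from `W
    -- i`, so one factor splits off.
    let U : Finset κ := s.biUnion W
    have hsub : ∀ j : s, W j ⊆ U := fun j => Finset.subset_biUnion_of_mem W j.2
    have hdisj : Disjoint (W i) U := (Finset.disjoint_biUnion_right _ _ _).2 fun j hj =>
      hW fun h => hi (h ▸ hj)
    have hind := hX.indepFun_finset (W i) U hdisj hXm
    have hE : (⋂ j ∈ s, (fun ω => g j fun k => X k ω) ⁻¹' B j) =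
        (fun ω (k : U) => X k ω) ⁻¹' ⋂ j : s, (fun y : U → β =>
          g j fun k => y ⟨k, hsub j k.2⟩) ⁻¹' B j := by
      ext ω
      simp
    rw [hE]
    refine hind.measure_inter_preimage_eq_mul (g i ⁻¹' B i) _
      (hg i (hB i (Finset.mem_insert_self _ _))) (MeasurableSet.iInter fun j => ?_)
    exact ((hg j).comp (by fun_prop)) (hB j (Finset.mem_insert_of_mem j.2))

theorem sum_eq_one_iff_exists {κ : Type*} {W : Finset κ} {x : κ → ℕ} :
    ∑ k ∈ W, x k = 1 ↔ ∃ k ∈ W, x k = 1 ∧ ∀ j ∈ W, j ≠ k → x j = 0 := by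
  classical
  constructor
  · intro h
    obtain ⟨k, hk, hk0⟩ : ∃ k ∈ W, x k ≠ 0 := Finset.exists_ne_zero_of_sum_ne_zero (by omega)
    rw [← Finset.add_sum_erase _ _ hk] at h
    have h0 : ∑ j ∈ W.erase k, x j = 0 := by omega
    exact ⟨k, hk, by omega, fun j hj hne =>
      Finset.sum_eq_zero_iff.1 h0 j (Finset.mem_erase.2 ⟨hne, hj⟩)⟩
  · rintro ⟨k, hk, h1, h0⟩
    rw [Finset.sum_eq_single_of_mem k hk h0, h1]

variable {κ : Type*} {X : κ → Ω → ℕ}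

theorem measureReal_sum_eq_zero (hX : iIndepFun X P) (W : Finset κ) :
    P.real {ω | ∑ k ∈ W, X k ω = 0} = ∏ k ∈ W, P.real {ω | X k ω = 0} := by
  have h := hX.measure_inter_preimage_eq_mul W (sets := fun _ => {0})
    fun _ _ => measurableSet_singleton 0
  have hE : {ω | ∑ k ∈ W, X k ω = 0} = ⋂ k ∈ W, X k ⁻¹' {0} := by
    ext ω
    simp [Finset.sum_eq_zero_iff]
  rw [measureReal_def, hE, h, ENNReal.toReal_prod]
  rfl

/-- Exactly one term equals `1` and the others vanish; these cases are disjoint. Since no `P(X k =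
0)` is zero, the product over the other indices is the full product divided by one factor, whence
the quotients of condition (ii). -/
theorem measureReal_sum_eq_one [IsProbabilityMeasure P] (hX : iIndepFun X P)
    (hXm : ∀ k, Measurable (X k)) {W : Finset κ}
    (hW : ∏ k ∈ W, P.real {ω | X k ω = 0} ≠ 0) :
    P.real {ω | ∑ k ∈ W, X k ω = 1} = (∏ k ∈ W, P.real {ω | X k ω = 0}) *
      ∑ k ∈ W, P.real {ω | X k ω = 1} / P.real {ω | X k ω = 0} := by
  classical
  let B : κ → κ → Set ℕ := fun k j => if j = k then {1} else {0}
  have hE : {ω | ∑ k ∈ W, X k ω = 1} = ⋃ k ∈ W, ⋂ j ∈ W, X j ⁻¹' B k j := by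
    ext ω
    simp only [mem_ofPred_eq, mem_iUnion, mem_iInter, exists_prop, mem_preimage, B]
    rw [sum_eq_one_iff_exists]
    refine exists_congr fun k => and_congr_right fun hk => ⟨fun h j hj => ?_, fun h => ⟨?_, ?_⟩⟩
    · split_ifs with hjk
      · exact hjk ▸ h.1
      · exact h.2 j hj hjk
    · simpa using h k hk
    · intro j hj hjk
      simpa [hjk] using h j hj
  have hpw : (W : Set κ).PairwiseDisjoint fun k => ⋂ j ∈ W, X j ⁻¹' B k j := by
    intro k hk k' hk' hne
    rw [Function.onFun, disjoint_left]
    intro ω h1 h2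
    have h1' := mem_iInter₂.1 h1 k hk
    have h2' := mem_iInter₂.1 h2 k hk
    simp only [B, mem_preimage, if_true, if_neg hne, mem_singleton_iff] at h1' h2'
    omega
  have hmeas : ∀ k ∈ W, MeasurableSet (⋂ j ∈ W, X j ⁻¹' B k j) := fun k _ =>
    W.measurableSet_biInter fun j _ => hXm j (MeasurableSet.of_discrete)
  rw [hE, measureReal_biUnion_finset hpw hmeas, Finset.mul_sum]
  refine Finset.sum_congr rfl fun k hk => ?_
  rw [measureReal_def, hX.measure_inter_preimage_eq_mul W
    fun _ _ => MeasurableSet.of_discrete, ENNReal.toReal_prod, ← Finset.mul_prod_erase _ _ hk,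
    ← Finset.mul_prod_erase _ (fun k => P.real {ω | X k ω = 0}) hk]
  have hk0 : P.real {ω | X k ω = 0} ≠ 0 := Finset.prod_ne_zero_iff.1 hW k hk
  have h1 : (P (X k ⁻¹' B k k)).toReal = P.real {ω | X k ω = 1} := by
    simp only [B, if_true]
    rfl
  have h2 : ∏ j ∈ W.erase k, (P (X j ⁻¹' B k j)).toReal =
      ∏ j ∈ W.erase k, P.real {ω | X j ω = 0} := by
    refine Finset.prod_congr rfl fun j hj => ?_
    simp only [B, if_neg (Finset.ne_of_mem_erase hj)]
    rfl
  rw [h1, h2]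
  field_simp

end Blocks

/-! ### The scaled process and the window condition -/

theorem finite_window {z : ℕ → ℝ} (htop : Tendsto z atTop atTop) (a b : ℝ) (n : ℕ) :
    (window z a b n).Finite := by
  obtain ⟨N, hN⟩ := eventually_atTop.1 (htop.eventually_gt_atTop (b * z n))
  refine (finite_lt_nat N).subset fun k hk => ?_
  by_contra h
  exact absurd hk.2 (not_le.2 (hN k (not_lt.1 h)))

instance : LocallyCompactSpace (Ioi (0 : ℝ)) := isOpen_Ioi.locallyCompactSpace

section ScaledProcess

variable {Ω : Type*} {z : ℕ → ℝ} (hpos : ∀ k, 0 < z k) (htop : Tendsto z atTop atTop)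
  {X : ℕ → Ω → ℕ}

theorem scaledProcess_subIoc (n : ℕ) (ω : Ω) (a b : ℝ) :
    (scaledProcess z hpos htop X n ω).toMeasure (subIoc a b) =
      ((∑ k ∈ (finite_window htop a b n).toFinset, X k ω : ℕ) : ℝ≥0∞) := by
  have hmem : ∀ k, (⟨z k / z n, div_pos (hpos k) (hpos n)⟩ : Ioi (0 : ℝ)) ∈ subIoc a b ↔
      k ∈ (finite_window htop a b n).toFinset := fun k => by
    rw [Finite.mem_toFinset, mem_subIoc]
    exact and_congr (lt_div_iff₀ (hpos n)) (div_le_iff₀ (hpos n))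
  rw [scaledProcess, Measure.sum_apply _ (measurableSet_subIoc a b),
    tsum_eq_sum (s := (finite_window htop a b n).toFinset)]
  · rw [Nat.cast_sum]
    refine Finset.sum_congr rfl fun k hk => ?_
    rw [Measure.smul_apply, Measure.dirac_apply' _ (measurableSet_subIoc a b),
      indicator_of_mem ((hmem k).2 hk)]
    simp
  · intro k hk
    rw [Measure.smul_apply, Measure.dirac_apply' _ (measurableSet_subIoc a b),
      indicator_of_notMem fun h => hk ((hmem k).1 h)]
    simp

theorem preimage_scaledProcess_subIoc (n m : ℕ) (a b : ℝ) :
    (fun ω => (scaledProcess z hpos htop X n ω).toMeasure (subIoc a b)) ⁻¹' {(m : ℝ≥0∞)} =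
      {ω | ∑ k ∈ (finite_window htop a b n).toFinset, X k ω = m} := by
  ext ω
  rw [mem_preimage, scaledProcess_subIoc, mem_singleton_iff, Nat.cast_inj]
  rfl

variable [MeasurableSpace Ω] (hXm : ∀ k, Measurable (X k))
include hXm

theorem measurable_scaledProcess (n : ℕ) : Measurable (scaledProcess z hpos htop X n) := by
  refine LocFinMeasure.measurable_of_lintegral fun f => ?_
  have hf : Measurable fun x => (f x : ℝ≥0∞) :=
    measurable_coe_nnreal_ennreal.comp f.continuous.measurable
  simp only [scaledProcess, lintegral_sum_measure, lintegral_smul_measure, lintegral_dirac' _ hf]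
  refine Measurable.tsum fun k => ?_
  exact ((measurable_of_countable (fun m : ℕ => (m : ℝ≥0∞))).comp (hXm k)).mul_const _

theorem measurable_scaledProcess_subIoc (n : ℕ) (a b : ℝ) :
    Measurable fun ω => (scaledProcess z hpos htop X n ω).toMeasure (subIoc a b) := by
  simp only [scaledProcess_subIoc]
  exact (measurable_of_countable (fun m : ℕ => (m : ℝ≥0∞))).comp
    (Finset.measurable_sum _ fun k _ => hXm k)

variable {P : Measure Ω} [IsProbabilityMeasure P] (hX : iIndepFun X P)
include hX

/-- Disjoint intervals see disjoint windows of indices, hence disjoint blocks of the `X k`. -/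
theorem iIndepFun_scaledProcess_subIoc (n m : ℕ) {t : ℕ → ℝ} (ht : Monotone t) :
    iIndepFun (fun (j : Fin m) ω => (scaledProcess z hpos htop X n ω).toMeasure
      (subIoc (t j) (t (j + 1)))) P := by
  have hW : Pairwise fun i j : Fin m => Disjoint
      (finite_window htop (t i) (t (i + 1)) n).toFinset
      (finite_window htop (t j) (t (j + 1)) n).toFinset := by
    intro i j hij
    rw [Finite.disjoint_toFinset, disjoint_left]
    intro k hk hk'
    have hmem : ∀ {a b : ℝ}, k ∈ window z a b n →
        (⟨z k / z n, div_pos (hpos k) (hpos n)⟩ : Ioi (0 : ℝ)) ∈ subIoc a b := fun h =>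
      mem_subIoc.2 ⟨(lt_div_iff₀ (hpos n)).2 h.1, (div_le_iff₀ (hpos n)).2 h.2⟩
    exact disjoint_left.1 (pairwise_disjoint_subIoc_succ ht m hij) (hmem hk) (hmem hk')
  have h := iIndepFun_finset_blocks hX hXm hW
    (g := fun j y => ((∑ k, y k : ℕ) : ℝ≥0∞)) fun j =>
      (measurable_of_countable (fun m : ℕ => (m : ℝ≥0∞))).comp
        (Finset.measurable_sum _ fun k _ => measurable_pi_apply k)
  refine (iIndepFun_congr fun j => Eventually.of_forall fun ω => ?_).1 h
  rw [scaledProcess_subIoc]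
  congr 1
  exact Finset.sum_coe_sort _ fun k => X k ω

theorem finprod_window_eq (n : ℕ) (a b : ℝ) :
    ∏ᶠ k ∈ window z a b n, P.real {ω | X k ω = 0} =
      P.real ((fun ω => (scaledProcess z hpos htop X n ω).toMeasure (subIoc a b)) ⁻¹' {0}) := by
  have h := preimage_scaledProcess_subIoc hpos htop (X := X) n 0 a b
  rw [Nat.cast_zero] at h
  rw [h, measureReal_sum_eq_zero hX, finprod_mem_eq_finite_toFinset_prod]

theorem mul_finsum_window_eq (n : ℕ) (a b : ℝ) (h0 : P.real
    ((fun ω => (scaledProcess z hpos htop X n ω).toMeasure (subIoc a b)) ⁻¹' {0}) ≠ 0) :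
    P.real ((fun ω => (scaledProcess z hpos htop X n ω).toMeasure (subIoc a b)) ⁻¹' {0}) *
      ∑ᶠ k ∈ window z a b n, P.real {ω | X k ω = 1} / P.real {ω | X k ω = 0} =
    P.real ((fun ω => (scaledProcess z hpos htop X n ω).toMeasure (subIoc a b)) ⁻¹' {1}) := by
  have h := preimage_scaledProcess_subIoc hpos htop (X := X) n 1 a b
  rw [Nat.cast_one] at h
  rw [← finprod_window_eq hpos htop hXm hX, finprod_mem_eq_finite_toFinset_prod _
    (finite_window htop a b n)] at h0 ⊢
  rw [h, measureReal_sum_eq_one hX hXm h0, finsum_mem_eq_finite_toFinset_sum]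

/-- The window condition in terms of the probabilities that the increments of the scaled process
are `0` or `1`. -/
theorem windowCondition_iff {c : ℝ} : WindowCondition z (fun k => P.real {ω | X k ω = 0})
      (fun k => P.real {ω | X k ω = 1}) c ↔
    (∀ a b, 0 < a → a < b → Tendsto (fun n => P.real
      ((fun ω => (scaledProcess z hpos htop X n ω).toMeasure (subIoc a b)) ⁻¹' {0})) atTop
        (𝓝 (Real.exp (-(c * Real.log (b / a)))))) ∧
    ∀ a b, 0 < a → a < b → ∀ r < Real.exp (-(c * Real.log (b / a))) * (c * Real.log (b / a)),
      ∀ᶠ n in atTop, r < P.real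
        ((fun ω => (scaledProcess z hpos htop X n ω).toMeasure (subIoc a b)) ⁻¹' {1}) := by
  have hpow : ∀ a b : ℝ, 0 < a → a < b → (a / b) ^ c = Real.exp (-(c * Real.log (b / a))) := by
    intro a b ha hab
    rw [Real.rpow_def_of_pos (div_pos ha (ha.trans hab)), ← inv_div b a, Real.log_inv]
    ring_nf
  have hiff : (∀ a b : ℝ, 0 < a → a < b →
      Tendsto (fun n => ∏ᶠ k ∈ window z a b n, P.real {ω | X k ω = 0}) atTop (𝓝 ((a / b) ^ c))) ↔
      ∀ a b, 0 < a → a < b → Tendsto (fun n => P.real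
      ((fun ω => (scaledProcess z hpos htop X n ω).toMeasure (subIoc a b)) ⁻¹' {0})) atTop
        (𝓝 (Real.exp (-(c * Real.log (b / a))))) := by
    refine forall₄_congr fun a b ha hab => ?_
    rw [hpow a b ha hab]
    simp only [finprod_window_eq hpos htop hXm hX]
  refine ⟨fun h => ⟨hiff.1 h.tendsto_prod, fun a b ha hab r hr => ?_⟩,
    fun h => ⟨hiff.2 h.1, fun a b ha hab => ?_⟩⟩
  · have h0 := hiff.1 h.tendsto_prod a b ha hab
    have hs := h.le_liminf_sum a b ha hab
    set l := c * Real.log (b / a)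
    have hpos' : ∀ᶠ n in atTop, 0 < P.real
        ((fun ω => (scaledProcess z hpos htop X n ω).toMeasure (subIoc a b)) ⁻¹' {0}) :=
      h0.eventually (lt_mem_nhds (Real.exp_pos _))
    -- Eventually the sum exceeds `s`, while the void probability times `s` exceeds `r`, its limit
    -- `exp (-l) * s` being larger than `r`.
    obtain ⟨s, hrs, hsl⟩ : ∃ s, r / Real.exp (-l) < s ∧ s < l :=
      exists_between ((div_lt_iff₀' (Real.exp_pos _)).2 hr)
    have e1 := eventually_lt_of_lt_liminf ((EReal.coe_lt_coe_iff.2 hsl).trans_le hs)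
    have e2 := (h0.mul_const s).eventually
      (lt_mem_nhds ((div_lt_iff₀' (Real.exp_pos _)).1 hrs))
    filter_upwards [hpos', e1, e2] with n hn h1 h2
    rw [← mul_finsum_window_eq hpos htop hXm hX n a b hn.ne']
    exact h2.trans (mul_lt_mul_of_pos_left (EReal.coe_lt_coe_iff.1 h1) hn)
  · have h0 := h.1 a b ha hab
    have h1 := h.2 a b ha hab
    set l := c * Real.log (b / a)
    have hpos' : ∀ᶠ n in atTop, 0 < P.real
        ((fun ω => (scaledProcess z hpos htop X n ω).toMeasure (subIoc a b)) ⁻¹' {0}) :=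
      h0.eventually (lt_mem_nhds (Real.exp_pos _))
    refine le_of_forall_lt fun y hy => ?_
    obtain ⟨s, hys, hsl⟩ := EReal.lt_iff_exists_real_btwn.1 hy
    refine hys.trans_le (le_liminf_of_le (by isBoundedDefault) ?_)
    have hsl' : Real.exp (-l) * s < Real.exp (-l) * l :=
      mul_lt_mul_of_pos_left (EReal.coe_lt_coe_iff.1 hsl) (Real.exp_pos _)
    -- With `r` strictly between, eventually `p0 * s < r < p1 = p0 * sum`, where `p0` and `p1` are
    -- the probabilities of the values `0` and `1`. Cancelling `p0 > 0` gives `s < sum`.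
    obtain ⟨r, hr1, hr2⟩ := exists_between hsl'
    filter_upwards [hpos', h1 r hr2, (h0.mul_const s).eventually (gt_mem_nhds hr1)] with n hn e1 e2
    rw [← mul_finsum_window_eq hpos htop hXm hX n a b hn.ne'] at e1
    exact EReal.coe_le_coe_iff.2 (lt_of_mul_lt_mul_left (e2.trans e1) hn.le).le

end ScaledProcess

/-! ### Necessity: squeezing intervals between bumps -/

namespace LocFinMeasure

section Sandwich

variable {S : Type*} [TopologicalSpace S] [MeasurableSpace S]

theorem measure_le_ofReal_pairing {g : C_c(S, ℝ≥0)} {A : Set S} (hA : MeasurableSet A)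
    (hg : ∀ x ∈ A, g x = 1) (μ : LocFinMeasure S) :
    μ.toMeasure A ≤ ENNReal.ofReal (pairing g μ) := by
  rw [ofReal_pairing, ← setLIntegral_one]
  exact (setLIntegral_mono' hA fun x hx => by simp [hg x hx]).trans (setLIntegral_le_lintegral A _)

theorem ofReal_pairing_le_measure {g : C_c(S, ℝ≥0)} {A : Set S} (hA : MeasurableSet A)
    (hg1 : ∀ x, g x ≤ 1) (hg0 : ∀ x ∉ A, g x = 0) (μ : LocFinMeasure S) :
    ENNReal.ofReal (pairing g μ) ≤ μ.toMeasure A := by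
  rw [ofReal_pairing, ← lintegral_indicator_one hA]
  refine lintegral_mono fun x => ?_
  by_cases hx : x ∈ A
  · simpa [hx] using hg1 x
  · simp [hx, hg0 x hx]

end Sandwich

variable {S : Type*} [TopologicalSpace S] [MeasurableSpace S]

/-- The portmanteau inequality for open conditions on the integrals of two test functions. -/
theorem eventually_lt_measureReal_pairing {Ω Ω' : Type*} [MeasurableSpace Ω]
    [MeasurableSpace Ω'] {P : Measure Ω} [IsProbabilityMeasure P] {P' : Measure Ω'}
    [IsProbabilityMeasure P'] {ξ : ℕ → Ω → LocFinMeasure S} {η : Ω' → LocFinMeasure S}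
    (h : TendstoInDistribution ξ atTop η (fun _ => P) P') (f g : C_c(S, ℝ≥0)) {V : Set (ℝ × ℝ)}
    (hV : IsOpen V) {r : ℝ} (hr : r < P'.real {ω | (pairing f (η ω), pairing g (η ω)) ∈ V}) :
    ∀ᶠ n in atTop, r < P.real {ω | (pairing f (ξ n ω), pairing g (ξ n ω)) ∈ V} := by
  have hc : Continuous fun μ : LocFinMeasure S => (pairing f μ, pairing g μ) :=
    (continuous_pairing f).prodMk (continuous_pairing g)
  have h' := h.continuous_comp hc
  have hport := ProbabilityMeasure.le_liminf_measure_open_of_tendsto h'.tendsto hV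
  simp only [ProbabilityMeasure.coe_mk] at hport
  rw [Measure.map_apply_of_aemeasurable h'.aemeasurable_limit hV.measurableSet] at hport
  simp only [Measure.map_apply_of_aemeasurable (h'.forall_aemeasurable _) hV.measurableSet] at hport
  rcases lt_or_ge r 0 with hr0 | hr0
  · exact Eventually.of_forall fun n => hr0.trans_le measureReal_nonneg
  · have hlt : ENNReal.ofReal r < P' {ω | (pairing f (η ω), pairing g (η ω)) ∈ V} :=
      (ENNReal.ofReal_lt_iff_lt_toReal hr0 (measure_ne_top _ _)).2 hr
    filter_upwards [eventually_lt_of_lt_liminf (hlt.trans_le hport)] with n hn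
    exact (ENNReal.ofReal_lt_iff_lt_toReal hr0 (measure_ne_top _ _)).1 hn

end LocFinMeasure

open LocFinMeasure

theorem exists_bump_subIoc {a b a' b' : ℝ} (ha : 0 < a) (haa : a < a') (hbb : b' < b) :
    ∃ g : C_c(Ioi (0 : ℝ), ℝ≥0), (∀ x, g x ≤ 1) ∧ (∀ x ∈ subIoc a' b', g x = 1) ∧
      ∀ x ∉ subIoc a b, g x = 0 := by
  have hK : IsCompact ((Subtype.val : Ioi (0 : ℝ) → ℝ) ⁻¹' Icc a' b') := by
    refine Topology.IsInducing.subtypeVal.isCompact_preimage' isCompact_Icc fun x hx => ?_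
    rw [Subtype.range_coe]
    exact (ha.trans haa).trans_le hx.1
  obtain ⟨g, h1, h2, h3⟩ := exists_compactlySupported_eq_one hK
    (isOpen_Ioo.preimage continuous_subtype_val)
    (preimage_mono (Icc_subset_Ioo haa hbb))
  exact ⟨g, h1, fun x hx => h2 x ⟨hx.1.le, hx.2⟩, fun x hx => h3 x fun h => hx ⟨h.1, h.2.le⟩⟩

/-- Chooses how far to widen or narrow an interval: strict inequalities at `0` persist for small `s
> 0`. -/
theorem exists_pos_forall_lt_of_continuous {φ : ℝ → ℝ} (hφ : Continuous φ) {ρ : ℝ → ℝ}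
    (hρ : Continuous ρ) {r q : ℝ} (hr : r < φ 0) (hq : q < ρ 0) :
    ∃ s > 0, r < φ s ∧ q < ρ s := by
  have h1 : ∀ᶠ s in 𝓝[>] (0 : ℝ), r < φ s ∧ q < ρ s :=
    nhdsWithin_le_nhds ((hφ.continuousAt.eventually (lt_mem_nhds hr)).and
      (hρ.continuousAt.eventually (lt_mem_nhds hq)))
  obtain ⟨s, hs, hs0⟩ := (h1.and self_mem_nhdsWithin).exists
  exact ⟨s, hs0, hs⟩

theorem log_mul_exp_div_mul_exp {a b : ℝ} (ha : 0 < a) (hb : 0 < b) (s t : ℝ) :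
    Real.log (b * Real.exp s / (a * Real.exp t)) = Real.log (b / a) + (s - t) := by
  rw [mul_div_mul_comm, ← Real.exp_sub, Real.log_mul (div_pos hb ha).ne' (Real.exp_pos _).ne',
    Real.log_exp]

section Necessity

variable {Ω Ω' : Type*} [MeasurableSpace Ω] [MeasurableSpace Ω'] {P : Measure Ω}
  [IsProbabilityMeasure P] {P' : Measure Ω'} [IsProbabilityMeasure P']
  {ξ : ℕ → Ω → LocFinMeasure (Ioi (0 : ℝ))} {η : Ω' → LocFinMeasure (Ioi (0 : ℝ))} {c : ℝ}
  (hc : 0 < c) (hη : IsPoissonProcess η P' (scaleInvariantIntensity c))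
  (hξ : TendstoInDistribution ξ atTop η (fun _ => P) P') {a b : ℝ} (ha : 0 < a) (hab : a < b)
include hc hη hξ ha hab

/-- Take a bump equal to `1` on `(a, b]` and supported in a wider interval. If `η` misses the wider
interval, the integral is below `1`; an integral of `ξ n` below `1` forces the integer mass of `(a,
b]` to vanish. -/
theorem eventually_lt_measureReal_subIoc_eq_zero
    (hnat : ∀ n ω, ∃ m : ℕ, (ξ n ω).toMeasure (subIoc a b) = m)
    {r : ℝ} (hr : r < Real.exp (-(c * Real.log (b / a)))) :
    ∀ᶠ n in atTop, r < P.real ((fun ω => (ξ n ω).toMeasure (subIoc a b)) ⁻¹' {0}) := by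
  have hb := ha.trans hab
  obtain ⟨s, hs, hrs, -⟩ := exists_pos_forall_lt_of_continuous
    (φ := fun s => Real.exp (-(c * (Real.log (b / a) + (s - -s))))) (by fun_prop)
    (ρ := fun _ => 1) continuous_const (r := r) (q := 0) (by simpa using hr) one_pos
  have ha' : a * Real.exp (-s) < a := mul_lt_of_lt_one_right ha (Real.exp_lt_one_iff.2 (by linarith))
  have hb' : b < b * Real.exp s := lt_mul_of_one_lt_right hb (Real.one_lt_exp_iff.2 hs)
  have ha0 : 0 < a * Real.exp (-s) := mul_pos ha (Real.exp_pos _)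
  have hlog := (log_div_pos ha0 (ha'.trans (hab.trans hb'))).le
  obtain ⟨g, hg1, hgK, hg0⟩ := exists_bump_subIoc ha0 ha' hb'
  have hμ := scaleInvariantIntensity_subIoc hc.le ha0 (ha'.trans (hab.trans hb')).le
  have hV : IsOpen {p : ℝ × ℝ | p.1 < 1} := isOpen_lt continuous_fst continuous_const
  have hlow : r < P'.real {ω | (pairing g (η ω), pairing g (η ω)) ∈ {p : ℝ × ℝ | p.1 < 1}} := by
    rw [← log_mul_exp_div_mul_exp ha hb, ← hη.measureReal_apply_eq_zero (measurableSet_subIoc _ _)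
      (mul_nonneg hc.le hlog) hμ] at hrs
    refine hrs.trans_le (measureReal_mono fun ω hω => ?_)
    have h1 := ofReal_pairing_le_measure (measurableSet_subIoc _ _) hg1 hg0 (η ω)
    rw [show (η ω).toMeasure _ = 0 from hω, nonpos_iff_eq_zero, ENNReal.ofReal_eq_zero] at h1
    exact h1.trans_lt one_pos
  filter_upwards [eventually_lt_measureReal_pairing hξ g g hV hlow] with n hn
  refine hn.trans_le (measureReal_mono fun ω hω => ?_)
  obtain ⟨m, hm⟩ := hnat n ω
  have h1 := measure_le_ofReal_pairing (measurableSet_subIoc _ _) hgK (ξ n ω)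
  have h2 : ENNReal.ofReal (pairing g (ξ n ω)) < 1 := ENNReal.ofReal_lt_one.2 hω
  have h3 := h1.trans_lt h2
  rw [hm] at h3
  have h4 : m = 0 := by
    have : (m : ℝ≥0∞) < (1 : ℕ) := by simpa using h3
    have := Nat.cast_lt.1 this
    omega
  simp [hm, h4]

/-- Complementary argument with a bump supported in `(a, b]` and equal to `1` on a narrower
interval: a positive integral shows that `(a, b]` is charged. -/
theorem eventually_measureReal_subIoc_eq_zero_lt
    (hm : ∀ n, AEMeasurable (fun ω => (ξ n ω).toMeasure (subIoc a b)) P)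
    {r : ℝ} (hr : Real.exp (-(c * Real.log (b / a))) < r) :
    ∀ᶠ n in atTop, P.real ((fun ω => (ξ n ω).toMeasure (subIoc a b)) ⁻¹' {0}) < r := by
  have hb := ha.trans hab
  obtain ⟨s, hs, hrs, hs'⟩ := exists_pos_forall_lt_of_continuous
    (φ := fun s => 1 - Real.exp (-(c * (Real.log (b / a) + (-s - s))))) (by fun_prop)
    (ρ := fun s => Real.log (b / a) + (-s - s)) (by fun_prop) (r := 1 - r) (q := 0)
    (by simpa using hr) (by simpa using log_div_pos ha hab)
  have ha' : a < a * Real.exp s := lt_mul_of_one_lt_right ha (Real.one_lt_exp_iff.2 hs)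
  have hb' : b * Real.exp (-s) < b := mul_lt_of_lt_one_right hb (Real.exp_lt_one_iff.2 (by linarith))
  rw [← log_mul_exp_div_mul_exp ha hb] at hrs hs'
  have ha0 : 0 < a * Real.exp s := mul_pos ha (Real.exp_pos _)
  have hb0 : 0 < b * Real.exp (-s) := mul_pos hb (Real.exp_pos _)
  have hab' : a * Real.exp s < b * Real.exp (-s) :=
    (one_lt_div ha0).1 ((Real.log_pos_iff (div_pos hb0 ha0).le).1 hs')
  obtain ⟨f, hf1, hfK, hf0⟩ := exists_bump_subIoc ha ha' hb'
  have hμ := scaleInvariantIntensity_subIoc hc.le ha0 hab'.le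
  have hV : IsOpen {p : ℝ × ℝ | 0 < p.1} := isOpen_lt continuous_const continuous_fst
  have hlow : 1 - r < P'.real {ω | (pairing f (η ω), pairing f (η ω)) ∈ {p : ℝ × ℝ | 0 < p.1}} := by
    rw [← hη.measureReal_apply_eq_zero (measurableSet_subIoc _ _)
      (mul_nonneg hc.le hs'.le) hμ, ← measureReal_preimage_ne_zero
      (hη.aemeasurable_apply (measurableSet_subIoc _ _) (by simp [hμ]))] at hrs
    refine hrs.trans_le (measureReal_mono fun ω hω => ?_)
    have h1 := measure_le_ofReal_pairing (measurableSet_subIoc _ _) hfK (η ω)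
    exact ENNReal.ofReal_pos.1 ((pos_iff_ne_zero.2 hω).trans_le h1)
  filter_upwards [eventually_lt_measureReal_pairing hξ f f hV hlow] with n hn
  have h2 : {ω | (pairing f (ξ n ω), pairing f (ξ n ω)) ∈ {p : ℝ × ℝ | 0 < p.1}} ⊆
      (fun ω => (ξ n ω).toMeasure (subIoc a b)) ⁻¹' {0}ᶜ := fun ω hω =>
    ((ENNReal.ofReal_pos.2 hω).trans_le (ofReal_pairing_le_measure (measurableSet_subIoc _ _)
      hf1 hf0 (ξ n ω))).ne'
  have h3 := hn.trans_le (measureReal_mono h2)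
  rw [measureReal_preimage_ne_zero (hm n)] at h3
  linarith

/-- The inner bump `f` has positive integral only if `(a, b]` is charged, and the outer bump `g` has
integral below `2` only if its mass is below `2`; an integer mass is then `1`. For `η` both
conditions hold when the narrowed interval has mass `1` and the two collars around `a` and `b` are
empty. -/
theorem eventually_lt_measureReal_subIoc_eq_one
    (hnat : ∀ n ω, ∃ m : ℕ, (ξ n ω).toMeasure (subIoc a b) = m)
    {r : ℝ} (hr : r < Real.exp (-(c * Real.log (b / a))) * (c * Real.log (b / a))) :
    ∀ᶠ n in atTop, r < P.real ((fun ω => (ξ n ω).toMeasure (subIoc a b)) ⁻¹' {1}) := by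
  have hb := ha.trans hab
  set L := Real.log (b / a) with hL
  obtain ⟨s, hs, hrs, hs'⟩ := exists_pos_forall_lt_of_continuous
    -- The probability under `η` of the masses `0, 1, 0` on the left collar, the narrowed interval
    -- and the right collar.
    (φ := fun s => Real.exp (-(c * (2 * s))) * (Real.exp (-(c * (L + (-s - s)))) *
      (c * (L + (-s - s)))) * Real.exp (-(c * (2 * s))))
    (by fun_prop) (ρ := fun s => L + (-s - s)) (by fun_prop) (r := r) (q := 0)
    (by simpa using hr) (by simpa using log_div_pos ha hab)
  -- Constant from index `3` on, so that `t` is monotone on all of `ℕ`.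
  let t : ℕ → ℝ := fun j => match j with
    | 0 => a * Real.exp (-s)
    | 1 => a * Real.exp s
    | 2 => b * Real.exp (-s)
    | _ => b * Real.exp s
  have ha' : a < t 1 := lt_mul_of_one_lt_right ha (Real.one_lt_exp_iff.2 hs)
  have hb' : t 2 < b := mul_lt_of_lt_one_right hb (Real.exp_lt_one_iff.2 (by linarith))
  have ha'' : t 0 < a := mul_lt_of_lt_one_right ha (Real.exp_lt_one_iff.2 (by linarith))
  have hb'' : b < t 3 := lt_mul_of_one_lt_right hb (Real.one_lt_exp_iff.2 hs)
  have ht0 : 0 < t 0 := mul_pos ha (Real.exp_pos _)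
  have ht1 : 0 < t 1 := mul_pos ha (Real.exp_pos _)
  have ht2 : 0 < t 2 := mul_pos hb (Real.exp_pos _)
  have hl0 : Real.log (t 1 / t 0) = 2 * s := by
    refine (log_mul_exp_div_mul_exp ha ha _ _).trans ?_
    rw [div_self ha.ne', Real.log_one]
    ring
  have hl1 : Real.log (t 2 / t 1) = L + (-s - s) := log_mul_exp_div_mul_exp ha hb _ _
  have hl2 : Real.log (t 3 / t 2) = 2 * s := by
    refine (log_mul_exp_div_mul_exp hb hb _ _).trans ?_
    rw [div_self hb.ne', Real.log_one]
    ring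
  have h12 : t 1 < t 2 := by
    rw [← hl1] at hs'
    exact (one_lt_div ht1).1 ((Real.log_pos_iff (div_pos ht2 ht1).le).1 hs')
  have hmono : Monotone t := monotone_nat_of_le_succ fun j => match j with
    | 0 => (ha''.trans ha').le
    | 1 => h12.le
    | 2 => (hb'.trans hb'').le
    | _ + 3 => le_rfl
  have hpos : ∀ j : ℕ, 0 < t j := fun j => ht0.trans_le (hmono (Nat.zero_le j))
  have hμ : ∀ j : Fin 3, scaleInvariantIntensity c (subIoc (t j) (t (j + 1))) =
      ENNReal.ofReal (c * Real.log (t (j + 1) / t j)) := fun j =>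
    scaleInvariantIntensity_subIoc hc.le (hpos _) (hmono (Nat.le_succ _))
  have hnn : ∀ j : Fin 3, 0 ≤ c * Real.log (t (j + 1) / t j) := fun j =>
    mul_nonneg hc.le (Real.log_nonneg ((one_le_div (hpos _)).2 (hmono (Nat.le_succ _))))
  have hind := hη.indep 3 (fun j => subIoc (t j) (t (j + 1))) (fun j => measurableSet_subIoc _ _)
    (fun j => by simp [hμ]) (pairwise_disjoint_subIoc_succ hmono 3)
  obtain ⟨f, hf1, hfK, hf0⟩ := exists_bump_subIoc ha ha' hb'
  obtain ⟨g, hg1, hgK, hg0⟩ := exists_bump_subIoc ht0 ha'' hb''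
  have hV : IsOpen {p : ℝ × ℝ | 0 < p.1 ∧ p.2 < 2} :=
    (isOpen_lt continuous_const continuous_fst).inter (isOpen_lt continuous_snd continuous_const)
  have hlow : r < P'.real {ω | (pairing f (η ω), pairing g (η ω)) ∈
      {p : ℝ × ℝ | 0 < p.1 ∧ p.2 < 2}} := by
    let B : Fin 3 → Set ℝ≥0∞ := ![{0}, {1}, {0}]
    have hB : ∀ j, MeasurableSet (B j) := fun j => by
      fin_cases j <;> exact measurableSet_singleton _
    have h1 := hind.measure_inter_preimage_eq_mul Finset.univ (sets := B) fun j _ => hB j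
    have h2 : P'.real (⋂ j ∈ (Finset.univ : Finset (Fin 3)),
        (fun ω => (η ω).toMeasure (subIoc (t j) (t (j + 1)))) ⁻¹' B j) =
        Real.exp (-(c * (2 * s))) * (Real.exp (-(c * (L + (-s - s)))) *
          (c * (L + (-s - s)))) * Real.exp (-(c * (2 * s))) := by
      have e0 := hη.measureReal_apply_eq_zero (measurableSet_subIoc _ _) (hnn 0) (hμ 0)
      have e1 := hη.measureReal_apply_eq_one (measurableSet_subIoc _ _) (hnn 1) (hμ 1)
      have e2 := hη.measureReal_apply_eq_zero (measurableSet_subIoc _ _) (hnn 2) (hμ 2)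
      rw [← hl1]
      nth_rw 1 [← hl0]
      rw [← hl2, measureReal_def, h1, ENNReal.toReal_prod, Fin.prod_univ_three]
      exact congrArg₂ _ (congrArg₂ _ e0 e1) e2
    rw [← h2] at hrs
    refine hrs.trans_le (measureReal_mono fun ω hω => ?_)
    simp only [Finset.mem_univ, iInter_true, mem_iInter] at hω
    have z0 : (η ω).toMeasure (subIoc (t 0) (t 1)) = 0 := hω 0
    have z1 : (η ω).toMeasure (subIoc (t 1) (t 2)) = 1 := hω 1
    have z2 : (η ω).toMeasure (subIoc (t 2) (t 3)) = 0 := hω 2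
    have hsub : subIoc (t 0) (t 3) ⊆
        subIoc (t 0) (t 1) ∪ (subIoc (t 1) (t 2) ∪ subIoc (t 2) (t 3)) := by
      intro y hy
      rcases le_or_gt (y : ℝ) (t 1) with h | h
      · exact Or.inl ⟨hy.1, h⟩
      · rcases le_or_gt (y : ℝ) (t 2) with h' | h'
        · exact Or.inr (Or.inl ⟨h, h'⟩)
        · exact Or.inr (Or.inr ⟨h', hy.2⟩)
    have hle : (η ω).toMeasure (subIoc (t 0) (t 3)) ≤ 1 := by
      refine (measure_mono hsub).trans ((measure_union_le _ _).trans ?_)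
      rw [z0, zero_add]
      refine (measure_union_le _ _).trans ?_
      rw [z1, z2, add_zero]
    have hf := measure_le_ofReal_pairing (measurableSet_subIoc _ _) hfK (η ω)
    rw [z1] at hf
    have hg := (ofReal_pairing_le_measure (measurableSet_subIoc _ _) hg1 hg0 (η ω)).trans hle
    exact ⟨ENNReal.ofReal_pos.1 (one_pos.trans_le hf),
      (ENNReal.ofReal_le_one.1 hg).trans_lt one_lt_two⟩
  filter_upwards [eventually_lt_measureReal_pairing hξ f g hV hlow] with n hn
  refine hn.trans_le (measureReal_mono fun ω hω => ?_)
  obtain ⟨m, hm⟩ := hnat n ω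
  have h1 := measure_le_ofReal_pairing (measurableSet_subIoc _ _) hgK (ξ n ω)
  have h2 : ENNReal.ofReal (pairing g (ξ n ω)) < 2 :=
    (ENNReal.ofReal_lt_ofReal_iff two_pos).2 hω.2 |>.trans_le (by simp)
  have h3 := h1.trans_lt h2
  have h4 := (ENNReal.ofReal_pos.2 hω.1).trans_le
    (ofReal_pairing_le_measure (measurableSet_subIoc _ _) hf1 hf0 (ξ n ω))
  rw [hm] at h3 h4
  have h5 : m = 1 := by
    have e1 : (m : ℝ≥0∞) < (2 : ℕ) := by simpa using h3
    have e1 := Nat.cast_lt.1 e1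
    have e2 := Nat.cast_pos.1 h4
    omega
  simp [hm, h5]

end Necessity

/-! ### Poisson samples -/

section CompoundPoisson

theorem integral_infinitePi_finset_prod {ι : Type*} {T : ι → Type*} [∀ i, MeasurableSpace (T i)]
    (Q : ∀ i, Measure (T i)) [∀ i, IsProbabilityMeasure (Q i)] (s : Finset ι)
    {f : ∀ i, T i → ℂ} (hf : ∀ i, Measurable (f i)) :
    ∫ ω, ∏ i ∈ s, f i (ω i) ∂(Measure.infinitePi Q) = ∏ i ∈ s, ∫ x, f i x ∂(Q i) := by
  have h := integral_restrict_infinitePi (μ := Q) (s := s)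
    (f := fun y : (∀ i : s, T i) => ∏ i : s, f i (y i))
    (Finset.measurable_prod Finset.univ fun (i : s) _ =>
      (hf i).comp (measurable_pi_apply i)).aestronglyMeasurable
  rw [integral_fintype_prod_eq_prod (fun (i : s) x => f i x),
    Finset.prod_coe_sort s fun i => ∫ x, f i x ∂(Q i)] at h
  rw [← h]
  congr 1 with ω
  exact (Finset.prod_coe_sort s fun i => f i (ω i)).symm

variable {T : Type*} [MeasurableSpace T]

theorem measurable_prod_range {β : Type*} [CommMonoid β] [MeasurableSpace β] [MeasurableMul₂ β]
    {g : T → β} (hg : Measurable g) :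
    Measurable fun p : ℕ × (ℕ → T) => ∏ i ∈ Finset.range p.1, g (p.2 i) :=
  measurable_from_prod_countable_right fun n =>
    Finset.measurable_prod (Finset.range n) fun i _ => hg.comp (measurable_pi_apply i)

/-- The law of a Poisson number together with an independent sequence of independent points. -/
noncomputable def poissonSampleLaw (r : ℝ≥0) (κ : Measure T) [IsProbabilityMeasure κ] :
    Measure (ℕ × (ℕ → T)) :=
  (poissonMeasure r).prod (Measure.infinitePi fun _ : ℕ => κ)

instance (r : ℝ≥0) (κ : Measure T) [IsProbabilityMeasure κ] :
    IsProbabilityMeasure (poissonSampleLaw r κ) := by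
  unfold poissonSampleLaw
  infer_instance

/-- Given the number `n` of points the integral is the `n`-th power of `∫ g`; averaging over `n`
sums an exponential series. -/
theorem integral_poissonSampleLaw_prod (r : ℝ≥0) (κ : Measure T) [IsProbabilityMeasure κ]
    {g : T → ℂ} (hg : Measurable g) (hg1 : ∀ x, ‖g x‖ ≤ 1) :
    ∫ p, ∏ i ∈ Finset.range p.1, g (p.2 i) ∂(poissonSampleLaw r κ) =
      Complex.exp (r * (∫ x, g x ∂κ - 1)) := by
  have hint : Integrable (fun p : ℕ × (ℕ → T) => ∏ i ∈ Finset.range p.1, g (p.2 i))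
      (poissonSampleLaw r κ) := by
    refine Integrable.of_bound (measurable_prod_range hg).aestronglyMeasurable 1
      (Eventually.of_forall fun p => ?_)
    rw [norm_prod]
    exact Finset.prod_le_one (fun _ _ => norm_nonneg _) fun i _ => hg1 _
  rw [poissonSampleLaw] at hint ⊢
  rw [integral_prod _ hint]
  simp only [integral_infinitePi_finset_prod _ _ fun _ => hg, Finset.prod_const, Finset.card_range]
  rw [integral_poissonMeasure]
  set w := ∫ x, g x ∂κ
  calc ∑' n : ℕ, (Real.exp (-r) * r ^ n / n.factorial) • w ^ n
      = ∑' n : ℕ, (Real.exp (-r) : ℂ) * ((r * w) ^ n / n.factorial) := by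
        congr with n
        rw [Complex.real_smul]
        push_cast
        rw [mul_pow]
        ring
    _ = Complex.exp (r * (w - 1)) := by
        rw [tsum_mul_left, (NormedSpace.expSeries_div_hasSum_exp (r * w)).tsum_eq,
          ← Complex.exp_eq_exp_ℂ, Complex.ofReal_exp, ← Complex.exp_add]
        push_cast
        ring_nf

/-- The number of sampled points in `B`. -/
noncomputable def sampleCount (B : Set T) (p : ℕ × (ℕ → T)) : ℕ :=
  ∑ i ∈ Finset.range p.1, B.indicator 1 (p.2 i)

theorem measurable_sampleCount {B : Set T} (hB : MeasurableSet B) :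
    Measurable (sampleCount B) :=
  measurable_from_prod_countable_right fun n => Finset.measurable_sum (Finset.range n) fun i _ =>
    (measurable_one.indicator hB).comp (measurable_pi_apply i)

/-- With `g` the indicator of `Bᶜ`, the product over the sample is the indicator that no point lies
in `B`. -/
theorem measureReal_sampleCount_eq_zero (r : ℝ≥0) (κ : Measure T) [IsProbabilityMeasure κ]
    {B : Set T} (hB : MeasurableSet B) :
    (poissonSampleLaw r κ).real {p | sampleCount B p = 0} = Real.exp (-(r * κ.real B)) := by
  have h := integral_poissonSampleLaw_prod r κ (g := Bᶜ.indicator 1)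
    (measurable_one.indicator hB.compl) fun x => by
      by_cases hx : x ∈ B <;> simp [hx]
  have hset : MeasurableSet {p : ℕ × (ℕ → T) | sampleCount B p = 0} :=
    measurable_sampleCount hB (measurableSet_singleton 0)
  have e : ∀ p : ℕ × (ℕ → T), ∏ i ∈ Finset.range p.1, Bᶜ.indicator (1 : T → ℂ) (p.2 i) =
      {p : ℕ × (ℕ → T) | sampleCount B p = 0}.indicator 1 p := by
    intro p
    by_cases hp : sampleCount B p = 0
    · rw [indicator_of_mem (by exact hp)]
      refine Finset.prod_eq_one fun i hi => ?_
      have := Finset.sum_eq_zero_iff.1 hp i hi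
      by_cases hx : p.2 i ∈ B
      · simp [hx] at this
      · simp [hx]
    · rw [indicator_of_notMem (by exact hp)]
      obtain ⟨i, hi, hne⟩ := Finset.exists_ne_zero_of_sum_ne_zero hp
      refine Finset.prod_eq_zero hi ?_
      by_cases hx : p.2 i ∈ B
      · simp [hx]
      · simp [hx] at hne
  simp only [e] at h
  have e1 : ∀ x, (Bᶜ.indicator (1 : T → ℂ) x) = Bᶜ.indicator (fun _ => (1 : ℂ)) x := fun x => rfl
  have e2 : ∀ p, ({p : ℕ × (ℕ → T) | sampleCount B p = 0}.indicator (1 : ℕ × (ℕ → T) → ℂ) p) =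
    {p : ℕ × (ℕ → T) | sampleCount B p = 0}.indicator (fun _ => (1 : ℂ)) p := fun x => rfl
  simp only [e1, e2] at h
  rw [integral_indicator_const _ hset, integral_indicator_const _ hB.compl,
    probReal_compl_eq_one_sub hB, Complex.real_smul, Complex.real_smul, mul_one, mul_one] at h
  apply Complex.ofReal_injective
  rw [h, Complex.ofReal_exp]
  push_cast
  ring_nf

end CompoundPoisson

/-! ### Superposition of independent samples -/

theorem exists_isProbabilityMeasure_smul_eq {T : Type*} [MeasurableSpace T] [Nonempty T]
    (ν : Measure T) [IsFiniteMeasure ν] :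
    ∃ κ : Measure T, IsProbabilityMeasure κ ∧ ∀ B, ν B = ν univ * κ B := by
  by_cases h : ν = 0
  · exact ⟨Measure.dirac (Classical.arbitrary T), inferInstance, fun B => by simp [h]⟩
  · have : NeZero ν := ⟨h⟩
    refine ⟨(ν univ)⁻¹ • ν, ⟨?_⟩, fun B => ?_⟩
    · rw [Measure.smul_apply, smul_eq_mul]
      exact ENNReal.inv_mul_cancel (NeZero.ne _) (measure_ne_top _ _)
    · rw [Measure.smul_apply, smul_eq_mul, ← mul_assoc,
        ENNReal.mul_inv_cancel (NeZero.ne _) (measure_ne_top _ _), one_mul]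

/-- The superposition of samples, where the `m`-th sample is restricted to `D m`. -/
noncomputable def superposition {S : Type*} [MeasurableSpace S] (D : ℕ → Set S)
    (ω : ℕ → ℕ × (ℕ → S)) : Measure S :=
  Measure.sum fun m => ∑ i ∈ Finset.range (ω m).1, (Measure.dirac ((ω m).2 i)).restrict (D m)

/-- The law of the independent samples. -/
noncomputable def samplesLaw {S : Type*} [MeasurableSpace S] (r : ℕ → ℝ≥0) (κ : ℕ → Measure S)
    [∀ m, IsProbabilityMeasure (κ m)] :
    Measure (ℕ → ℕ × (ℕ → S)) :=
  Measure.infinitePi fun m => poissonSampleLaw (r m) (κ m)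

instance {S : Type*} [MeasurableSpace S] (r : ℕ → ℝ≥0) (κ : ℕ → Measure S)
    [∀ m, IsProbabilityMeasure (κ m)] : IsProbabilityMeasure (samplesLaw r κ) := by
  unfold samplesLaw
  infer_instance

section Superposition

variable {S : Type*} [MeasurableSpace S] {D : ℕ → Set S} (hD : ∀ m, MeasurableSet (D m))
include hD

theorem superposition_apply (ω : ℕ → ℕ × (ℕ → S)) {A : Set S} (hA : MeasurableSet A) :
    superposition D ω A = ∑' m, (sampleCount (A ∩ D m) (ω m) : ℝ≥0∞) := by
  rw [superposition, Measure.sum_apply _ hA]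
  refine tsum_congr fun m => ?_
  rw [Measure.finsetSum_apply, sampleCount, Nat.cast_sum]
  refine Finset.sum_congr rfl fun i _ => ?_
  rw [Measure.restrict_apply hA, Measure.dirac_apply' _ (hA.inter (hD m))]
  by_cases h : (ω m).2 i ∈ A ∩ D m
  · rw [indicator_of_mem h, indicator_of_mem h]
    simp
  · rw [indicator_of_notMem h, indicator_of_notMem h]
    simp

theorem lintegral_superposition (ω : ℕ → ℕ × (ℕ → S)) {f : S → ℝ≥0∞} (hf : Measurable f) :
    ∫⁻ x, f x ∂(superposition D ω) =
      ∑' m, ∑ i ∈ Finset.range (ω m).1, (D m).indicator f ((ω m).2 i) := by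
  rw [superposition, lintegral_sum_measure]
  refine tsum_congr fun m => ?_
  rw [lintegral_finsetSum_measure]
  refine Finset.sum_congr rfl fun i _ => ?_
  rw [← lintegral_indicator (hD m), lintegral_dirac' _ (hf.indicator (hD m))]

theorem superposition_apply_eq_sum {ω : ℕ → ℕ × (ℕ → S)} {A : Set S} (hA : MeasurableSet A)
    {M : ℕ} (hM : ∀ m, M ≤ m → sampleCount (A ∩ D m) (ω m) = 0) :
    superposition D ω A = ((∑ m ∈ Finset.range M, sampleCount (A ∩ D m) (ω m) : ℕ) : ℝ≥0∞) := by
  rw [superposition_apply hD ω hA, tsum_eq_sum (s := Finset.range M), Nat.cast_sum]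
  intro m hm
  rw [hM m (by simpa using hm), Nat.cast_zero]

variable (hdisj : Pairwise fun i j => Disjoint (D i) (D j)) (hcov : ⋃ m, D m = univ)
  {μ : Measure S} {r : ℕ → ℝ≥0} {κ : ℕ → Measure S} [∀ m, IsProbabilityMeasure (κ m)]
  (hκ : ∀ m B, MeasurableSet B → μ (B ∩ D m) = r m * κ m (B ∩ D m))
include hdisj hcov hκ

theorem hasSum_measureReal_inter {A : Set S} (hA : MeasurableSet A) (hμ : μ A ≠ ∞) :
    HasSum (fun m => r m * (κ m).real (A ∩ D m)) (μ.real A) := by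
  have h1 : ∀ m, r m * (κ m).real (A ∩ D m) = μ.real (A ∩ D m) := fun m => by
    rw [measureReal_def, measureReal_def, hκ m A hA, ENNReal.toReal_mul, ENNReal.coe_toReal]
  simp only [h1]
  have h2 : μ A = ∑' m, μ (A ∩ D m) := by
    rw [← measure_iUnion (fun i j hij => (hdisj hij).mono inter_subset_right inter_subset_right)
      fun m => hA.inter (hD m), ← inter_iUnion, hcov, inter_univ]
  rw [h2] at hμ
  rw [measureReal_def, h2, ENNReal.tsum_toReal_eq fun m => ENNReal.ne_top_of_tsum_ne_top hμ m]
  exact ENNReal.hasSum_toReal hμ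

/-- Borel–Cantelli: piece `m` contributes with probability `1 - exp (-x) ≤ x`, where `x = μ (A ∩ D
m)` is summable. Hence the mass of `A` is almost surely a finite sum. -/
theorem ae_eventually_sampleCount_eq_zero {A : Set S} (hA : MeasurableSet A) (hμ : μ A ≠ ∞) :
    ∀ᵐ ω ∂(samplesLaw r κ), ∃ M, ∀ m, M ≤ m → sampleCount (A ∩ D m) (ω m) = 0 := by
  have hle : ∀ m, samplesLaw r κ {ω | sampleCount (A ∩ D m) (ω m) ≠ 0} ≤
      ENNReal.ofReal (r m * (κ m).real (A ∩ D m)) := by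
    intro m
    have hm := hA.inter (hD m)
    have hset : MeasurableSet {p : ℕ × (ℕ → S) | sampleCount (A ∩ D m) p = 0} :=
      measurable_sampleCount hm (measurableSet_singleton 0)
    have h1 : samplesLaw r κ {ω | sampleCount (A ∩ D m) (ω m) ≠ 0} =
        poissonSampleLaw (r m) (κ m) {p | sampleCount (A ∩ D m) p = 0}ᶜ :=
      (measurePreserving_eval_infinitePi (fun m => poissonSampleLaw (r m) (κ m)) m).measure_preimage
        hset.compl.nullMeasurableSet
    rw [h1, ← ofReal_measureReal, probReal_compl_eq_one_sub hset,
      measureReal_sampleCount_eq_zero _ _ hm]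
    refine ENNReal.ofReal_le_ofReal ?_
    linarith [Real.add_one_le_exp (-(r m * (κ m).real (A ∩ D m)))]
  have hsum := (hasSum_measureReal_inter hD hdisj hcov hκ hA hμ).summable
  have hfin : ∑' m, samplesLaw r κ {ω | sampleCount (A ∩ D m) (ω m) ≠ 0} ≠ ∞ :=
    ne_top_of_le_ne_top hsum.tsum_ofReal_ne_top (ENNReal.tsum_le_tsum hle)
  filter_upwards [ae_eventually_notMem hfin] with ω hω
  obtain ⟨M, hM⟩ := eventually_atTop.1 hω
  exact ⟨M, fun m hm => by simpa using hM m hm⟩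

/-- The joint characteristic function of the masses of disjoint sets. -/
theorem integral_exp_superposition {d : ℕ} {A : Fin d → Set S} (hA : ∀ j, MeasurableSet (A j))
    (hμ : ∀ j, μ (A j) ≠ ∞) (hAd : Pairwise fun i j => Disjoint (A i) (A j)) (t : Fin d → ℝ) :
    ∫ ω, Complex.exp ((∑ j, t j * (superposition D ω (A j)).toReal : ℝ) * Complex.I)
        ∂(samplesLaw r κ) =
      Complex.exp (∑ j, μ.real (A j) * (Complex.exp (t j * Complex.I) - 1)) := by
  -- The contribution of the first `M` pieces. Its characteristic function factorizes over
  -- independent pieces, and dominated convergence lets `M` tend to infinity.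
  let Z : ℕ → (ℕ → ℕ × (ℕ → S)) → ℝ := fun M ω =>
    ∑ m ∈ Finset.range M, ∑ j, t j * sampleCount (A j ∩ D m) (ω m)
  have hZm : ∀ M, Measurable (Z M) := fun M => Finset.measurable_sum _ fun m _ =>
    Finset.measurable_sum _ fun j _ => ((measurable_of_countable (fun k : ℕ => (k : ℝ))).comp
      ((measurable_sampleCount ((hA j).inter (hD m))).comp (measurable_pi_apply m))).const_mul _
  have hlim : Tendsto (fun M => ∫ ω, Complex.exp (Z M ω * Complex.I) ∂(samplesLaw r κ)) atTop
      (𝓝 (∫ ω, Complex.exp ((∑ j, t j * (superposition D ω (A j)).toReal : ℝ) * Complex.I)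
        ∂(samplesLaw r κ))) := by
    refine tendsto_integral_of_dominated_convergence (fun _ => 1)
      (fun M => Measurable.aestronglyMeasurable (by fun_prop)) (integrable_const _)
      (fun M => Eventually.of_forall fun ω => (Complex.norm_exp_ofReal_mul_I _).le) ?_
    have hae := ae_all_iff.2 fun j => ae_eventually_sampleCount_eq_zero hD hdisj hcov hκ (hA j)
      (hμ j)
    filter_upwards [hae] with ω hω
    choose M hM using hω
    refine tendsto_const_nhds.congr' ?_
    filter_upwards [eventually_all.2 fun j => eventually_ge_atTop (M j)] with N hN
    have : ∀ j, (superposition D ω (A j)).toReal =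
        ∑ m ∈ Finset.range N, (sampleCount (A j ∩ D m) (ω m) : ℝ) := fun j => by
      rw [superposition_apply_eq_sum hD (hA j) fun m hm => hM j m ((hN j).trans hm),
        ENNReal.toReal_natCast, Nat.cast_sum]
    simp only [this, Finset.mul_sum, Z]
    rw [Finset.sum_comm]
  have hpart : ∀ M, ∫ ω, Complex.exp (Z M ω * Complex.I) ∂(samplesLaw r κ) =
      Complex.exp (∑ m ∈ Finset.range M, ∑ j, ((r m * (κ m).real (A j ∩ D m) : ℝ) : ℂ) *
        (Complex.exp (t j * Complex.I) - 1)) := by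
    intro M
    let g : ℕ → S → ℂ := fun m x =>
      Complex.exp ((∑ j, t j * (A j ∩ D m).indicator 1 x : ℝ) * Complex.I)
    have hg : ∀ m, Measurable (g m) := fun m => by
      have : ∀ j, Measurable fun x => (A j ∩ D m).indicator (1 : S → ℝ) x := fun j =>
        measurable_one.indicator ((hA j).inter (hD m))
      fun_prop
    have hsplit : ∀ ω, Complex.exp (Z M ω * Complex.I) =
        ∏ m ∈ Finset.range M, ∏ i ∈ Finset.range (ω m).1, g m ((ω m).2 i) := by
      intro ω
      simp only [g, ← Complex.exp_sum, ← Finset.sum_mul, ← Complex.ofReal_sum]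
      congr 3
      refine Finset.sum_congr rfl fun m _ => ?_
      rw [Finset.sum_comm]
      refine Finset.sum_congr rfl fun j _ => ?_
      rw [← Finset.mul_sum, sampleCount, Nat.cast_sum]
      congr 1
      refine Finset.sum_congr rfl fun i _ => ?_
      by_cases h : (ω m).2 i ∈ A j ∩ D m
      · rw [indicator_of_mem h, indicator_of_mem h]
        simp
      · rw [indicator_of_notMem h, indicator_of_notMem h]
        simp
    have hgint : ∀ m, ∫ x, g m x ∂(κ m) =
        1 + ∑ j, (κ m).real (A j ∩ D m) * (Complex.exp (t j * Complex.I) - 1) := by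
      intro m
      -- A point lies in at most one of the disjoint sets `A j`, so the exponential of the sum has
      -- at most one nontrivial term and becomes linear in the indicators.
      have hgx : ∀ x, g m x = 1 + ∑ j, (A j ∩ D m).indicator
          (fun _ => Complex.exp (t j * Complex.I) - 1) x := by
        intro x
        by_cases hx : ∃ j, x ∈ A j ∩ D m
        · obtain ⟨j, hj⟩ := hx
          have hne : ∀ i, i ≠ j → x ∉ A i ∩ D m := fun i hij h =>
            disjoint_left.1 (hAd hij) h.1 hj.1
          simp only [g]
          rw [Finset.sum_eq_single j (fun i _ hij => by rw [indicator_of_notMem (hne i hij), mul_zero])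
            (by simp), Finset.sum_eq_single j (fun i _ hij => indicator_of_notMem (hne i hij) _)
            (by simp), indicator_of_mem hj, indicator_of_mem hj]
          simp
        · push Not at hx
          simp only [g]
          rw [Finset.sum_eq_zero fun j _ => by rw [indicator_of_notMem (hx j), mul_zero],
            Finset.sum_eq_zero fun j _ => indicator_of_notMem (hx j) _]
          simp
      simp only [hgx]
      have hi : ∀ j ∈ Finset.univ, Integrable ((A j ∩ D m).indicator
          fun _ => Complex.exp (t j * Complex.I) - 1) (κ m) := fun j _ =>
        (integrable_const _).indicator ((hA j).inter (hD m))
      rw [integral_add (integrable_const _) (integrable_finsetSum _ hi), integral_finsetSum _ hi]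
      simp [integral_indicator_const _ ((hA _).inter (hD m))]
    simp only [hsplit]
    rw [samplesLaw, integral_infinitePi_finset_prod
      (f := fun m (p : ℕ × (ℕ → S)) => ∏ i ∈ Finset.range p.1, g m (p.2 i)) _ _ fun m =>
        measurable_prod_range (hg m), Complex.exp_sum]
    refine Finset.prod_congr rfl fun m _ => ?_
    rw [integral_poissonSampleLaw_prod _ _ (hg m) fun x =>
      (Complex.norm_exp_ofReal_mul_I _).le, hgint, add_sub_cancel_left, Finset.mul_sum]
    congr 1
    refine Finset.sum_congr rfl fun j _ => ?_
    push_cast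
    ring
  refine tendsto_nhds_unique hlim ?_
  simp only [hpart]
  refine (Complex.continuous_exp.tendsto _).comp ?_
  simp only [Finset.sum_comm (s := Finset.range _)]
  refine tendsto_finsetSum _ fun j _ => ?_
  simp only [← Finset.sum_mul, ← Complex.ofReal_sum]
  exact ((Complex.continuous_ofReal.tendsto _).comp
    (hasSum_measureReal_inter hD hdisj hcov hκ (hA j) (hμ j)).tendsto_sum_nat).mul_const _

end Superposition

/-! ### Poisson laws and independence from characteristic functions -/

section PoissonLaw

variable {S : Type*} [MeasurableSpace S] {D : ℕ → Set S} (hD : ∀ m, MeasurableSet (D m))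
  (hdisj : Pairwise fun i j => Disjoint (D i) (D j)) (hcov : ⋃ m, D m = univ)
  {μ : Measure S} {r : ℕ → ℝ≥0} {κ : ℕ → Measure S} [∀ m, IsProbabilityMeasure (κ m)]
  (hκ : ∀ m B, MeasurableSet B → μ (B ∩ D m) = r m * κ m (B ∩ D m))
include hD

theorem measurable_superposition_apply {A : Set S} (hA : MeasurableSet A) :
    Measurable fun ω => superposition D ω A := by
  simp only [superposition_apply hD _ hA]
  exact Measurable.tsum fun m => (measurable_of_countable (fun k : ℕ => (k : ℝ≥0∞))).comp
    ((measurable_sampleCount (hA.inter (hD m))).comp (measurable_pi_apply m))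

theorem measurable_toReal_superposition_apply {A : Set S} (hA : MeasurableSet A) :
    Measurable fun ω => (superposition D ω A).toReal :=
  (measurable_superposition_apply hD hA).ennreal_toReal

include hdisj hcov hκ

theorem ae_ofReal_toReal_superposition {A : Set S} (hA : MeasurableSet A) (hμ : μ A ≠ ∞) :
    ∀ᵐ ω ∂(samplesLaw r κ),
      ENNReal.ofReal (superposition D ω A).toReal = superposition D ω A := by
  filter_upwards [ae_eventually_sampleCount_eq_zero hD hdisj hcov hκ hA hμ] with ω ⟨M, hM⟩
  rw [superposition_apply_eq_sum hD hA hM]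
  exact ENNReal.ofReal_toReal (ENNReal.natCast_ne_top _)

theorem charFun_map_toReal_superposition {A : Set S} (hA : MeasurableSet A) (hμ : μ A ≠ ∞)
    (t : ℝ) : charFun ((samplesLaw r κ).map fun ω => (superposition D ω A).toReal) t =
      Complex.exp (μ.real A * (Complex.exp (t * Complex.I) - 1)) := by
  have h := integral_exp_superposition hD hdisj hcov hκ (d := 1) (A := fun _ => A) (fun _ => hA)
    (fun _ => hμ) (fun i j hij => absurd (Subsingleton.elim i j) hij) fun _ => t
  simp only [Fin.sum_univ_one] at h
  rw [charFun_apply, integral_map (measurable_toReal_superposition_apply hD hA).aemeasurable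
    (Measurable.aestronglyMeasurable (by fun_prop)), ← h]
  congr 1 with ω

theorem map_superposition_apply {A : Set S} (hA : MeasurableSet A) (hμ : μ A ≠ ∞) :
    (samplesLaw r κ).map (fun ω => superposition D ω A) =
      (poissonMeasure (μ A).toNNReal).map (fun m : ℕ => (m : ℝ≥0∞)) := by
  have hm := measurable_toReal_superposition_apply hD hA
  have : IsProbabilityMeasure ((samplesLaw r κ).map fun ω => (superposition D ω A).toReal) :=
    Measure.isProbabilityMeasure_map hm.aemeasurable
  have h : (samplesLaw r κ).map (fun ω => (superposition D ω A).toReal) =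
      (poissonMeasure (μ A).toNNReal).map (fun m : ℕ => (m : ℝ)) := by
    refine Measure.ext_of_charFun (funext fun t => ?_)
    rw [charFun_map_toReal_superposition hD hdisj hcov hκ hA hμ, charFun_map_cast_poissonMeasure]
    rfl
  have h' := congrArg (Measure.map ENNReal.ofReal) h
  rw [Measure.map_map ENNReal.measurable_ofReal hm, Measure.map_map ENNReal.measurable_ofReal
    (measurable_of_countable _)] at h'
  refine (Measure.map_congr ?_).trans (h'.trans (Measure.map_congr ?_))
  · filter_upwards [ae_ofReal_toReal_superposition hD hdisj hcov hκ hA hμ] with ω hω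
    exact hω.symm
  · exact Eventually.of_forall fun m => ENNReal.ofReal_natCast m

/-- The joint characteristic function of the real-valued masses is the product of the marginal ones;
the masses are almost surely finite, so independence carries over to `ℝ≥0∞`. -/
theorem iIndepFun_superposition {d : ℕ} {A : Fin d → Set S} (hA : ∀ j, MeasurableSet (A j))
    (hμ : ∀ j, μ (A j) ≠ ∞) (hAd : Pairwise fun i j => Disjoint (A i) (A j)) :
    iIndepFun (fun j ω => superposition D ω (A j)) (samplesLaw r κ) := by
  have hm := fun j => measurable_toReal_superposition_apply hD (hA j)
  have h : iIndepFun (fun j ω => (superposition D ω (A j)).toReal) (samplesLaw r κ) := by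
    refine (iIndepFun_iff_charFun_pi fun j => (hm j).aemeasurable).2 fun t => ?_
    simp only [fun j => charFun_map_toReal_superposition hD hdisj hcov hκ (hA j) (hμ j)]
    rw [← Complex.exp_sum, ← integral_exp_superposition hD hdisj hcov hκ hA hμ hAd, charFun_apply,
      integral_map (Measurable.aemeasurable (by fun_prop))
      (Measurable.aestronglyMeasurable (by fun_prop))]
    congr 1 with ω
  refine (iIndepFun_congr fun j => ?_).1 (h.comp (fun _ => ENNReal.ofReal)
    fun _ => ENNReal.measurable_ofReal)
  exact ae_ofReal_toReal_superposition hD hdisj hcov hκ (hA j) (hμ j)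

end PoissonLaw

/-- Poisson processes exist for intensity measures that are finite on compact sets. -/
theorem exists_isPoissonProcess {S : Type} [TopologicalSpace S] [MeasurableSpace S] [BorelSpace S]
    [SecondCountableTopology S] [LocallyCompactSpace S] [T2Space S] [Nonempty S] (μ : Measure S)
    [IsFiniteMeasureOnCompacts μ] :
    ∃ (Ω : Type) (_ : MeasurableSpace Ω) (P : Measure Ω) (_ : IsProbabilityMeasure P)
      (η : Ω → LocFinMeasure S), IsPoissonProcess η P μ := by
  let K : CompactExhaustion S := default
  let D : ℕ → Set S := disjointed K
  have hD : ∀ m, MeasurableSet (D m) := MeasurableSet.disjointed fun m =>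
    (K.isCompact m).measurableSet
  have hdisj : Pairwise fun i j => Disjoint (D i) (D j) := disjoint_disjointed K
  have hcov : ⋃ m, D m = univ := by
    rw [iUnion_disjointed]
    exact K.iUnion_eq
  have hfin : ∀ m, μ (D m) ≠ ∞ := fun m =>
    ne_top_of_le_ne_top (K.isCompact m).measure_lt_top.ne (measure_mono (disjointed_subset _ m))
  have hex : ∀ m, ∃ κ : Measure S, IsProbabilityMeasure κ ∧
      ∀ B, μ.restrict (D m) B = μ.restrict (D m) univ * κ B := fun m => by
    have : IsFiniteMeasure (μ.restrict (D m)) := ⟨by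
      rw [Measure.restrict_apply_univ]
      exact (hfin m).lt_top⟩
    exact exists_isProbabilityMeasure_smul_eq _
  choose κ hκp hκ using hex
  let r : ℕ → ℝ≥0 := fun m => (μ (D m)).toNNReal
  have hκ' : ∀ m B, MeasurableSet B → μ (B ∩ D m) = r m * κ m (B ∩ D m) := by
    intro m B hB
    have h := hκ m (B ∩ D m)
    rwa [Measure.restrict_apply (hB.inter (hD m)), Measure.restrict_apply_univ, inter_assoc,
      inter_self, ← ENNReal.coe_toNNReal (hfin m)] at h
  -- The restriction of sample `m` to `D m` makes this true for every `ω`, not just almost surely: a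
  -- compact set inside `K M` misses `D m` for `m ≥ M + 1`.
  have hcompact : ∀ ω, IsFiniteMeasureOnCompacts (superposition D ω) := by
    refine fun ω => ⟨fun C hC => ?_⟩
    obtain ⟨M, hM⟩ := K.exists_superset_of_isCompact hC
    rw [superposition_apply_eq_sum hD hC.measurableSet (M := M + 1)]
    · exact ENNReal.natCast_lt_top _
    · intro m hm
      have hemp : C ∩ D m = ∅ := by
        rw [← disjoint_iff_inter_eq_empty, disjoint_left]
        intro x hx hxm
        have hx' : x ∈ ⋃ i ∈ Finset.range (M + 1), D i := by
          rw [biUnion_range_succ_disjointed]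
          exact le_partialSups (fun i => K i) M (hM hx)
        obtain ⟨i, hi, hxi⟩ := mem_iUnion₂.1 hx'
        have := Finset.mem_range.1 hi
        exact disjoint_left.1 (hdisj (show i ≠ m by omega)) hxi hxm
      simp [hemp, sampleCount]
  refine ⟨_, inferInstance, samplesLaw r κ, inferInstance, fun ω => ⟨superposition D ω, hcompact ω⟩,
    ⟨?_, ?_, ?_⟩⟩
  · refine LocFinMeasure.measurable_of_lintegral fun f => ?_
    have hf : Measurable fun x => (f x : ℝ≥0∞) :=
      measurable_coe_nnreal_ennreal.comp f.continuous.measurable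
    simp only [lintegral_superposition hD _ hf]
    refine Measurable.tsum fun m => ?_
    have h : Measurable fun p : ℕ × (ℕ → S) =>
        ∑ i ∈ Finset.range p.1, (D m).indicator (fun x => (f x : ℝ≥0∞)) (p.2 i) :=
      measurable_from_prod_countable_right fun n =>
        Finset.measurable_sum (Finset.range n) fun i _ =>
          (hf.indicator (hD m)).comp (measurable_pi_apply i)
    exact h.comp (measurable_pi_apply m)
  · exact fun A hA hμ => map_superposition_apply hD hdisj hcov hκ' hA hμ
  · exact fun m A hA hμ hAd => iIndepFun_superposition hD hdisj hcov hκ' hA hμ hAd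

theorem isFiniteMeasureOnCompacts_scaleInvariantIntensity {c : ℝ} (hc : 0 ≤ c) :
    IsFiniteMeasureOnCompacts (scaleInvariantIntensity c) := by
  refine ⟨fun K hK => ?_⟩
  obtain ⟨a, b, ha, hab, h⟩ := exists_subIoc_superset hK
  refine (measure_mono h).trans_lt ?_
  rw [scaleInvariantIntensity_subIoc hc ha hab.le]
  exact ENNReal.ofReal_lt_top

/-- Necessity works with whatever realization of `η_c` is given; sufficiency has to produce one,
which is why existence of Poisson processes is needed. -/
theorem convergesToScaleInvariantPoisson_iff {Ω : Type*} [MeasurableSpace Ω] (P : Measure Ω)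
    [IsProbabilityMeasure P] (z : ℕ → ℝ) (hz_pos : ∀ k, 0 < z k) (hz_top : Tendsto z atTop atTop)
    (X : ℕ → Ω → ℕ) (hX_meas : ∀ k, Measurable (X k)) (hX_indep : iIndepFun X P) {c : ℝ}
    (hc : 0 < c) :
    ConvergesToScaleInvariantPoisson P (scaledProcess z hz_pos hz_top X) c ↔
      WindowCondition z (fun k => P.real {ω | X k ω = 0}) (fun k => P.real {ω | X k ω = 1}) c := by
  rw [windowCondition_iff hz_pos hz_top hX_meas hX_indep]
  have hm : ∀ n a b, AEMeasurable
      (fun ω => (scaledProcess z hz_pos hz_top X n ω).toMeasure (subIoc a b)) P := fun n a b =>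
    (measurable_scaledProcess_subIoc hz_pos hz_top hX_meas n a b).aemeasurable
  constructor
  · rintro ⟨Ω', _, P', _, η, hη, hξ⟩
    have hnat : ∀ a b n ω, ∃ m : ℕ,
        (scaledProcess z hz_pos hz_top X n ω).toMeasure (subIoc a b) = m := fun a b n ω =>
      ⟨_, scaledProcess_subIoc hz_pos hz_top n ω a b⟩
    refine ⟨fun a b ha hab => tendsto_order.2 ⟨fun r hr => ?_, fun r hr => ?_⟩,
      fun a b ha hab r hr => ?_⟩
    · exact eventually_lt_measureReal_subIoc_eq_zero hc hη hξ ha hab (hnat a b) hr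
    · exact eventually_measureReal_subIoc_eq_zero_lt hc hη hξ ha hab (fun n => hm n a b) hr
    · exact eventually_lt_measureReal_subIoc_eq_one hc hη hξ ha hab (hnat a b) hr
  · rintro ⟨h0, h1⟩
    have := isFiniteMeasureOnCompacts_scaleInvariantIntensity hc.le
    have : Nonempty (Ioi (0 : ℝ)) := ⟨⟨1, mem_Ioi.2 one_pos⟩⟩
    obtain ⟨Ω', hΩ', P', hP', η, hη⟩ := exists_isPoissonProcess (scaleInvariantIntensity c)
    refine ⟨Ω', hΩ', P', hP', η, hη, ?_⟩
    have hξ := measurable_scaledProcess hz_pos hz_top hX_meas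
    refine LocFinMeasure.tendstoInDistribution_of_tendsto_integral hξ hη.measurable
      fun I F K C hF hC => ?_
    exact tendsto_integral_pairings_of_tendsto_increments hc hη hξ (fun n a b _ _ => hm n a b)
      (fun n m t _ ht => iIndepFun_scaledProcess_subIoc hz_pos hz_top hX_meas hX_indep n m ht)
      h0 h1 I hF hC

theorem theorem3p2 {Ω : Type*} [MeasurableSpace Ω] (P : Measure Ω) [IsProbabilityMeasure P]
    (z : ℕ → ℝ) (hz_pos : ∀ k, 0 < z k) (hz_mono : Monotone z) (hz_top : Tendsto z atTop atTop)
    (X : ℕ → Ω → ℕ) (hX_meas : ∀ k, Measurable (X k)) (hX_indep : iIndepFun X P) :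
    (∀ c : ℝ, 0 < c →
      (ConvergesToScaleInvariantPoisson P (scaledProcess z hz_pos hz_top X) c ↔
        WindowCondition z (fun k => P.real {ω | X k ω = 0}) (fun k => P.real {ω | X k ω = 1}) c)) ∧
    ((∃ c : ℝ, 0 < c ∧
        ConvergesToScaleInvariantPoisson P (scaledProcess z hz_pos hz_top X) c) ↔
      ∃ c : ℝ, 0 < c ∧
        WindowCondition z (fun k => P.real {ω | X k ω = 0})
          (fun k => P.real {ω | X k ω = 1}) c) := by
  have key := fun c (hc : 0 < c) =>
    convergesToScaleInvariantPoisson_iff P z hz_pos hz_top X hX_meas hX_indep hc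
  exact ⟨key, exists_congr fun c => and_congr_right fun hc => key c hc⟩
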